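/- Let $n,m,N\ge 0$ be integers, let $(\Omega,\mathfrak F,\mathbb P)$ be a probability space carrying an $\mathbb R^n$-valued random vector $\xi$ and real random variables $\omega_0,\dots,\omega_{N-1}$, and put $\mathfrak F_{k-1}=\sigma(\xi,\omega_0,\dots,\omega_{k-1})$ for $0\le k<N$ (so $\mathfrak F_{-1}=\sigma(\xi)$). Assume that, for $0\le k<N$, $\omega_k$ is square integrable with $\mathbb E[\omega_k\mid\mathfrak F_{k-1}]=0$ and $\mathbb E[\omega_k^2\mid\mathfrak F_{k-1}]=1$. Let $A_k,\bar A_k,C_k,\bar C_k\in\mathbb R^{n\times n}$, $B_k,\bar B_k,D_k,\bar D_k\in\mathbb R^{n\times m}$, $S_k,\bar S_k\in\mathbb R^{m\times n}$ be deterministic matrices, and let $Q_k,\bar Q_k,G,\bar G\in\mathbb R^{n\times n}$, $R_k,\bar R_k\in\mathbb R^{m\times m}$ be deterministic symmetric matrices, not assumed to be definite. Let $\mathscr U_{ad}$ be the set of controls $u=(u_0,\dots,u_{N-1})$ such that $u_k$ is $\mathbb R^m$-valued, $\mathfrak F_{k-1}$-measurable and square integrable. For $u\in\mathscr U_{ad}$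 let $x_0=0$, $$x_{k+1}=A_kx_k+\bar A_k\mathbb Ex_k+B_ku_k+\bar B_k\mathbb Eu_k+(C_kx_k+\bar C_k\mathbb Ex_k+D_ku_k+\bar D_k\mathbb Eu_k)\,\omega_k,\qquad 0\le k<N,$$ and $$J^0(0,0;u)=\mathbb E\Big\{\langle Gx_N,x_N\rangle+\langle\bar G\,\mathbb Ex_N,\mathbb Ex_N\rangle+\sum_{k=0}^{N-1}\Big[\langle Q_kx_k,x_k\rangle+2\langle S_kx_k,u_k\rangle+\langle R_ku_k,u_k\rangle+\langle\bar Q_k\mathbb Ex_k,\mathbb Ex_k\rangle+2\langle\bar S_k\mathbb Ex_k,\mathbb Eu_k\rangle+\langle\bar R_k\mathbb Eu_k,\mathbb Eu_k\rangle\Big]\Big\}.$$ For $n\times n$ matrices $P_0,\dots,P_N$ and $\Pi_0,\dots,\Pi_N$ put, for $0\le k<N$, $$\Upsilon_k=R_k+B_k'P_{k+1}B_k+D_k'P_{k+1}D_k,\qquad H_k=B_k'P_{k+1}A_k+D_k'P_{k+1}C_k+S_k,$$ $$\bar\Upsilon_k=R_k+\bar R_k+(B_k+\bar B_k)'\Pi_{k+1}(B_k+\bar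 B_k)+(D_k+\bar D_k)'P_{k+1}(D_k+\bar D_k),$$ $$\bar H_k=(B_k+\bar B_k)'\Pi_{k+1}(A_k+\bar A_k)+(D_k+\bar D_k)'P_{k+1}(C_k+\bar C_k)+S_k+\bar S_k.$$ The generalized Riccati equations (GRE) are, with $\dagger$ the Moore-Penrose pseudoinverse and $0\le k<N$, $$P_k=Q_k+A_k'P_{k+1}A_k+C_k'P_{k+1}C_k-H_k'\Upsilon_k^\dagger H_k,\qquad P_N=G,$$ $$\Pi_k=Q_k+\bar Q_k+(A_k+\bar A_k)'\Pi_{k+1}(A_k+\bar A_k)+(C_k+\bar C_k)'P_{k+1}(C_k+\bar C_k)-\bar H_k'\bar\Upsilon_k^\dagger\bar H_k,\qquad \Pi_N=G+\bar G.$$ Consider the statements: (i) the map $u\mapsto J^0(0,0;u)$ is uniformly convex, i.e. there is $\alpha>0$ with $J^0(0,0;u)\ge\alpha\,\mathbb E\sum_{k=0}^{N-1}|u_k|^2$ for all $u\in\mathscr U_{ad}$; (ii) the GRE have a strongly regular solution $(P,\Pi)$, i.e. a solution for which there is $\alpha>0$ with $\Upsilon_k\ge\alpha I$ and $\bar\Upsilon_k\ge\alpha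 I$ for all $0\le k<N$. Then (ii) implies (i). If moreover $\xi$ is not almost surely constant (so that $\mathfrak F_{-1}$ is not trivial), then (i) and (ii) are equivalent. -/

import Mathlib

open MeasureTheory Matrix

namespace MFLQ

noncomputable section

/-- `X` is the Moore-Penrose pseudoinverse of `M`: the four Penrose equations.  Such an `X` is
unique, see `IsMoorePenrose.unique`. -/
structure IsMoorePenrose {p q : ℕ} (M : Matrix (Fin p) (Fin q) ℝ)
    (X : Matrix (Fin q) (Fin p) ℝ) : Prop where
  mul_mul : M * X * M = M
  mul_mul' : X * M * X = X
  symm_left : (M * X)ᵀ = M * X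
  symm_right : (X * M)ᵀ = X * M

theorem IsMoorePenrose.unique {p q : ℕ} {M : Matrix (Fin p) (Fin q) ℝ}
    {X Y : Matrix (Fin q) (Fin p) ℝ} (hX : IsMoorePenrose M X) (hY : IsMoorePenrose M Y) :
    X = Y := by
  have e1 : M * X = M * Y := by
    calc M * X = (M * X)ᵀ := hX.symm_left.symm
      _ = ((M * Y) * (M * X))ᵀ := by
          rw [← Matrix.mul_assoc (M * Y) M X, hY.mul_mul]
      _ = (M * X) * (M * Y) := by
          rw [Matrix.transpose_mul, hX.symm_left, hY.symm_left]
      _ = M * Y := by rw [← Matrix.mul_assoc (M * X) M Y, hX.mul_mul]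
  have e2 : X * M = Y * M := by
    calc X * M = (X * M)ᵀ := hX.symm_right.symm
      _ = ((X * M) * (Y * M))ᵀ := by
          rw [Matrix.mul_assoc X M (Y * M), ← Matrix.mul_assoc M Y M, hY.mul_mul]
      _ = (Y * M) * (X * M) := by
          rw [Matrix.transpose_mul, hX.symm_right, hY.symm_right]
      _ = Y * M := by rw [Matrix.mul_assoc Y M (X * M), ← Matrix.mul_assoc M X M, hX.mul_mul]
  calc X = X * M * X := hX.mul_mul'.symm
    _ = Y * (M * X) := by rw [e2, Matrix.mul_assoc]
    _ = Y * (M * Y) := by rw [e1]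
    _ = Y := by rw [← Matrix.mul_assoc, hY.mul_mul']

/-- The deterministic coefficients of the homogeneous mean-field LQ problem with state in `ℝⁿ`
and control in `ℝᵐ`.  Only the indices `k < N` of the time-dependent ones are ever used. -/
structure Coeffs (n m : ℕ) where
  A : ℕ → Matrix (Fin n) (Fin n) ℝ
  Abar : ℕ → Matrix (Fin n) (Fin n) ℝ
  B : ℕ → Matrix (Fin n) (Fin m) ℝ
  Bbar : ℕ → Matrix (Fin n) (Fin m) ℝ
  C : ℕ → Matrix (Fin n) (Fin n) ℝ
  Cbar : ℕ → Matrix (Fin n) (Fin n) ℝ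
  D : ℕ → Matrix (Fin n) (Fin m) ℝ
  Dbar : ℕ → Matrix (Fin n) (Fin m) ℝ
  Q : ℕ → Matrix (Fin n) (Fin n) ℝ
  Qbar : ℕ → Matrix (Fin n) (Fin n) ℝ
  S : ℕ → Matrix (Fin m) (Fin n) ℝ
  Sbar : ℕ → Matrix (Fin m) (Fin n) ℝ
  R : ℕ → Matrix (Fin m) (Fin m) ℝ
  Rbar : ℕ → Matrix (Fin m) (Fin m) ℝ
  G : Matrix (Fin n) (Fin n) ℝ
  Gbar : Matrix (Fin n) (Fin n) ℝ

/-- The weights `Q, Q̄, R, R̄, G, Ḡ` are symmetric (nothing is assumed about definiteness). -/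
structure Coeffs.SymmetricWeights {n m : ℕ} (c : Coeffs n m) (N : ℕ) : Prop where
  Q : ∀ k < N, (c.Q k).IsSymm
  Qbar : ∀ k < N, (c.Qbar k).IsSymm
  R : ∀ k < N, (c.R k).IsSymm
  Rbar : ∀ k < N, (c.Rbar k).IsSymm
  G : c.G.IsSymm
  Gbar : c.Gbar.IsSymm

/-! ### The stochastic side -/

section Stochastic

variable {n m : ℕ} {Ω : Type*} [MeasurableSpace Ω]

/-- The information `𝓕_{k-1} = σ(ξ, ω₀, …, ω_{k-1})` available just before the noise `ω_k`
is realized; for `k = 0` it is `σ(ξ)`. -/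
@[reducible] def info (ξ : Ω → Fin n → ℝ) (ω : ℕ → Ω → ℝ) (k : ℕ) : MeasurableSpace Ω :=
  MeasurableSpace.comap ξ inferInstance ⊔
    ⨆ (j : ℕ) (_ : j < k), MeasurableSpace.comap (ω j) inferInstance

/-- `ω₀, …, ω_{N-1}` is a martingale difference sequence with unit conditional variance:
`𝔼[ω_k | 𝓕_{k-1}] = 0` and `𝔼[ω_k² | 𝓕_{k-1}] = 1`. -/
structure IsNoise (μ : Measure Ω) (ξ : Ω → Fin n → ℝ) (ω : ℕ → Ω → ℝ) (N : ℕ) : Prop where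
  measurable : ∀ k < N, Measurable (ω k)
  memLp : ∀ k < N, MemLp (ω k) 2 μ
  condExp_eq_zero : ∀ k < N, μ[ω k | info ξ ω k] =ᵐ[μ] fun _ => 0
  condExp_sq_eq_one : ∀ k < N, μ[fun s => ω k s ^ 2 | info ξ ω k] =ᵐ[μ] fun _ => 1

/-- Admissible controls `u₀, …, u_{N-1}`: `u_k` is `𝓕_{k-1}`-measurable and square integrable
(the choice of the norm on `ℝᵐ` does not matter for the latter). -/
def Admissible (μ : Measure Ω) (ξ : Ω → Fin n → ℝ) (ω : ℕ → Ω → ℝ) (N : ℕ)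
    (u : ℕ → Ω → Fin m → ℝ) : Prop :=
  ∀ k < N, Measurable[info ξ ω k] (u k) ∧ MemLp (u k) 2 μ

/-- The state of the homogeneous system started at time `0` in `x₀`:
`x_{k+1} = A x_k + Ā 𝔼x_k + B u_k + B̄ 𝔼u_k + (C x_k + C̄ 𝔼x_k + D u_k + D̄ 𝔼u_k) ω_k`. -/
def state (c : Coeffs n m) (μ : Measure Ω) (ω : ℕ → Ω → ℝ) (x₀ : Ω → Fin n → ℝ)
    (u : ℕ → Ω → Fin m → ℝ) : ℕ → Ω → Fin n → ℝ
  | 0 => x₀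
  | k + 1 => fun s =>
      c.A k *ᵥ state c μ ω x₀ u k s + c.Abar k *ᵥ (∫ t, state c μ ω x₀ u k t ∂μ)
        + c.B k *ᵥ u k s + c.Bbar k *ᵥ (∫ t, u k t ∂μ)
        + ω k s • (c.C k *ᵥ state c μ ω x₀ u k s + c.Cbar k *ᵥ (∫ t, state c μ ω x₀ u k t ∂μ)
            + c.D k *ᵥ u k s + c.Dbar k *ᵥ (∫ t, u k t ∂μ))

/-- The quadratic form of the symmetric block matrix with rows `(Q, Sᵀ)` and `(S, R)` at
the vector `(x, u)`. -/
def blockForm (Q : Matrix (Fin n) (Fin n) ℝ) (S : Matrix (Fin m) (Fin n) ℝ)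
    (R : Matrix (Fin m) (Fin m) ℝ) (x : Fin n → ℝ) (u : Fin m → ℝ) : ℝ :=
  (Q *ᵥ x + Sᵀ *ᵥ u) ⬝ᵥ x + (S *ᵥ x + R *ᵥ u) ⬝ᵥ u

/-- The homogeneous cost functional `J⁰(0, x₀; u)` with horizon `N`. -/
def cost (c : Coeffs n m) (μ : Measure Ω) (ω : ℕ → Ω → ℝ) (N : ℕ) (x₀ : Ω → Fin n → ℝ)
    (u : ℕ → Ω → Fin m → ℝ) : ℝ :=
  let x := state c μ ω x₀ u
  ∫ s, ((c.G *ᵥ x N s) ⬝ᵥ x N s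
      + (c.Gbar *ᵥ (∫ t, x N t ∂μ)) ⬝ᵥ (∫ t, x N t ∂μ)
      + ∑ k ∈ Finset.range N,
          (blockForm (c.Q k) (c.S k) (c.R k) (x k s) (u k s)
            + blockForm (c.Qbar k) (c.Sbar k) (c.Rbar k)
                (∫ t, x k t ∂μ) (∫ t, u k t ∂μ))) ∂μ

/-- Uniform convexity of `u ↦ J⁰(0, 0; u)` on the admissible controls: for some `α > 0`,
`J⁰(0, 0; u) ≥ α 𝔼 ∑_{k<N} |u_k|²` (Euclidean norm) for every admissible `u`. -/
def UniformlyConvex (c : Coeffs n m) (μ : Measure Ω) (ξ : Ω → Fin n → ℝ) (ω : ℕ → Ω → ℝ)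
    (N : ℕ) : Prop :=
  ∃ α : ℝ, 0 < α ∧ ∀ u : ℕ → Ω → Fin m → ℝ, Admissible μ ξ ω N u →
    α * ∫ s, ∑ k ∈ Finset.range N, u k s ⬝ᵥ u k s ∂μ ≤ cost c μ ω N (fun _ => 0) u

end Stochastic

/-! ### The generalized Riccati equations -/

section Riccati

variable {n m : ℕ}

/-- `Υ_k = R + Bᵀ P B + Dᵀ P D`, where `P` stands for `P_{k+1}`. -/
def Coeffs.Upsilon (c : Coeffs n m) (k : ℕ) (P : Matrix (Fin n) (Fin n) ℝ) :
    Matrix (Fin m) (Fin m) ℝ :=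
  c.R k + (c.B k)ᵀ * P * c.B k + (c.D k)ᵀ * P * c.D k

/-- `Ῡ_k = R + R̄ + (B + B̄)ᵀ Π (B + B̄) + (D + D̄)ᵀ P (D + D̄)`, where `P`, `V` stand for
`P_{k+1}`, `Π_{k+1}`. -/
def Coeffs.UpsilonBar (c : Coeffs n m) (k : ℕ) (P V : Matrix (Fin n) (Fin n) ℝ) :
    Matrix (Fin m) (Fin m) ℝ :=
  c.R k + c.Rbar k + (c.B k + c.Bbar k)ᵀ * V * (c.B k + c.Bbar k)
    + (c.D k + c.Dbar k)ᵀ * P * (c.D k + c.Dbar k)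

/-- `H_k = Bᵀ P A + Dᵀ P C + S`, where `P` stands for `P_{k+1}`. -/
def Coeffs.H (c : Coeffs n m) (k : ℕ) (P : Matrix (Fin n) (Fin n) ℝ) :
    Matrix (Fin m) (Fin n) ℝ :=
  (c.B k)ᵀ * P * c.A k + (c.D k)ᵀ * P * c.C k + c.S k

/-- `H̄_k = (B + B̄)ᵀ Π (A + Ā) + (D + D̄)ᵀ P (C + C̄) + S + S̄`, where `P`, `V` stand for
`P_{k+1}`, `Π_{k+1}`. -/
def Coeffs.HBar (c : Coeffs n m) (k : ℕ) (P V : Matrix (Fin n) (Fin n) ℝ) :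
    Matrix (Fin m) (Fin n) ℝ :=
  (c.B k + c.Bbar k)ᵀ * V * (c.A k + c.Abar k)
    + (c.D k + c.Dbar k)ᵀ * P * (c.C k + c.Cbar k) + (c.S k + c.Sbar k)

/-- `(P, V)`, `V` standing for `Π`, solves the generalized Riccati equations on `{0, …, N}`.
In the equations `X` is the pseudoinverse of `Υ_k` and `Y` that of `Ῡ_k`. -/
structure IsRiccatiSolution (c : Coeffs n m) (N : ℕ) (P V : ℕ → Matrix (Fin n) (Fin n) ℝ) :
    Prop where
  terminal_P : P N = c.G
  terminal_V : V N = c.G + c.Gbar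
  step_P : ∀ k < N, ∃ X, IsMoorePenrose (c.Upsilon k (P (k + 1))) X ∧
    P k = c.Q k + (c.A k)ᵀ * P (k + 1) * c.A k + (c.C k)ᵀ * P (k + 1) * c.C k
      - (c.H k (P (k + 1)))ᵀ * X * c.H k (P (k + 1))
  step_V : ∀ k < N, ∃ Y, IsMoorePenrose (c.UpsilonBar k (P (k + 1)) (V (k + 1))) Y ∧
    V k = c.Q k + c.Qbar k + (c.A k + c.Abar k)ᵀ * V (k + 1) * (c.A k + c.Abar k)
      + (c.C k + c.Cbar k)ᵀ * P (k + 1) * (c.C k + c.Cbar k)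
      - (c.HBar k (P (k + 1)) (V (k + 1)))ᵀ * Y * c.HBar k (P (k + 1)) (V (k + 1))

/-- A solution is strongly regular if `Υ_k ≥ αI` and `Ῡ_k ≥ αI` (in the Loewner order) for all
`k < N`, with some `α > 0` that does not depend on `k`. -/
def IsStronglyRegular (c : Coeffs n m) (N : ℕ) (P V : ℕ → Matrix (Fin n) (Fin n) ℝ) : Prop :=
  ∃ α : ℝ, 0 < α ∧ ∀ k < N,
    (c.Upsilon k (P (k + 1)) - α • (1 : Matrix (Fin m) (Fin m) ℝ)).PosSemidef ∧
    (c.UpsilonBar k (P (k + 1)) (V (k + 1)) - α • (1 : Matrix (Fin m) (Fin m) ℝ)).PosSemidef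

/-- The generalized Riccati equations are strongly regularly solvable. -/
def StronglyRegularlySolvable (c : Coeffs n m) (N : ℕ) : Prop :=
  ∃ P V : ℕ → Matrix (Fin n) (Fin n) ℝ, IsRiccatiSolution c N P V ∧ IsStronglyRegular c N P V

end Riccati

end

end MFLQ

/-! Split every random vector into its fluctuation and its mean. Let `meanFieldForm μ P V f` be the
form `P` of the fluctuation of `f`, averaged, plus the form `V` of its mean. Conditional mean zero
and conditional variance one of the noise give the form of the next state as the form `(P, V)` of
the drift plus the form `(P, P)` of the diffusion coefficient (`meanFieldForm_nextState`): the noise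
term has mean zero, so its whole second moment is fluctuation, which is why `P` and not `Π`
multiplies the diffusion in both Riccati equations. Completing the square separately in fluctuation
and mean and telescoping turns the cost into a sum over `k` of the forms `(Υ_k, Ῡ_k)` of the gap
`u_k + feedback` (`cost_eq_sum_meanFieldForm`).

Sufficiency: under strong regularity the cost dominates the sum of second moments of the gaps.
Conversely the gaps determine the control through a linear recursion bounded in mean square, so they
control the second moments of `u` (`exists_sum_secondMoment_control_le`).

Necessity: with inverses in place of pseudoinverses the recursion always has a solution, and it
solves the true equations once it is strongly regular. Regularity is proved backwards in time. A
control that vanishes before `K`, equals `w` at `K` and follows the optimal feedback afterwards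
costs exactly the form `(Υ_K, Ῡ_K)` of `w` (`exists_admissible_cost_eq_meanFieldForm`), so convexity
bounds this form below by `α 𝔼|w|²`. Constant `w` tests `Ῡ_K`; centered `w = η z` tests `Υ_K`. At `K
= 0` a nonzero centered `η` exists only because `ξ` is not almost surely constant. -/

namespace MFLQ

/-! ### Completing the square, and Loewner bounds as scalar inequalities -/

section LinearAlgebra

variable {n m p q : ℕ}

theorem dotProduct_mulVec_transpose (M : Matrix (Fin p) (Fin q) ℝ) (v : Fin p → ℝ)
    (w : Fin q → ℝ) : v ⬝ᵥ (M *ᵥ w) = (Mᵀ *ᵥ v) ⬝ᵥ w := by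
  rw [dotProduct_mulVec, mulVec_transpose]

theorem mulVec_dotProduct_comm (M : Matrix (Fin p) (Fin q) ℝ) (v : Fin p → ℝ)
    (w : Fin q → ℝ) : (M *ᵥ w) ⬝ᵥ v = (Mᵀ *ᵥ v) ⬝ᵥ w := by
  rw [dotProduct_comm, dotProduct_mulVec_transpose]

/-- `V` weighs the drift and `P` the diffusion, so one identity serves both equations: with `V = P`
for the fluctuation, with the barred sums of coefficients for the mean. Invertibility only serves to
cancel `Y * Y⁻¹` on `H x`, so `x = 0` can replace it; necessity needs this at times where
invertibility is not yet known. -/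
theorem complete_square {P V Q A C : Matrix (Fin n) (Fin n) ℝ} {B D : Matrix (Fin n) (Fin m) ℝ}
    {S H : Matrix (Fin m) (Fin n) ℝ} {R Y : Matrix (Fin m) (Fin m) ℝ}
    (hP : P.IsSymm) (hV : V.IsSymm) (hR : R.IsSymm)
    (hY : Y = R + Bᵀ * V * B + Dᵀ * P * D) (hH : H = Bᵀ * V * A + Dᵀ * P * C + S)
    {x : Fin n → ℝ} (hu : IsUnit Y ∨ x = 0)
    (u : Fin m → ℝ) :
    (V *ᵥ (A *ᵥ x + B *ᵥ u)) ⬝ᵥ (A *ᵥ x + B *ᵥ u)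
      + (P *ᵥ (C *ᵥ x + D *ᵥ u)) ⬝ᵥ (C *ᵥ x + D *ᵥ u) + blockForm Q S R x u
    = ((Q + Aᵀ * V * A + Cᵀ * P * C - Hᵀ * Y⁻¹ * H) *ᵥ x) ⬝ᵥ x
      + (Y *ᵥ (u + Y⁻¹ *ᵥ (H *ᵥ x))) ⬝ᵥ (u + Y⁻¹ *ᵥ (H *ᵥ x)) := by
  have hYs : Yᵀ = Y := by
    rw [hY]
    simp only [transpose_add, transpose_mul, transpose_transpose, hP.eq, hV.eq, hR.eq,
      Matrix.mul_assoc]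
  have hYi : Y⁻¹ᵀ = Y⁻¹ := by rw [transpose_nonsing_inv, hYs]
  have e1 : (Y *ᵥ (u + Y⁻¹ *ᵥ (H *ᵥ x))) ⬝ᵥ (u + Y⁻¹ *ᵥ (H *ᵥ x))
      = (Y *ᵥ u) ⬝ᵥ u + 2 * ((H *ᵥ x) ⬝ᵥ u) + ((Hᵀ * Y⁻¹ * H) *ᵥ x) ⬝ᵥ x := by
    have a1 : Y *ᵥ (Y⁻¹ *ᵥ (H *ᵥ x)) = H *ᵥ x := by
      rcases hu with hu | rfl
      · rw [mulVec_mulVec, mul_nonsing_inv _ ((isUnit_iff_isUnit_det _).1 hu), one_mulVec]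
      · simp
    have a2 : (Y *ᵥ u) ⬝ᵥ (Y⁻¹ *ᵥ (H *ᵥ x)) = (H *ᵥ x) ⬝ᵥ u := by
      rw [mulVec_dotProduct_comm, hYs, a1]
    have a3 : (H *ᵥ x) ⬝ᵥ (Y⁻¹ *ᵥ (H *ᵥ x)) = ((Hᵀ * Y⁻¹ * H) *ᵥ x) ⬝ᵥ x := by
      rw [mulVec_dotProduct_comm, mulVec_mulVec, mulVec_mulVec]
    rw [mulVec_add, a1, add_dotProduct, dotProduct_add, dotProduct_add, a2, a3]
    ring
  have e2 : (S *ᵥ x) ⬝ᵥ u = (Sᵀ *ᵥ u) ⬝ᵥ x := mulVec_dotProduct_comm _ _ _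
  have cross : ∀ (M A : Matrix (Fin n) (Fin n) ℝ) (B : Matrix (Fin n) (Fin m) ℝ), M.IsSymm →
      (M *ᵥ (A *ᵥ x + B *ᵥ u)) ⬝ᵥ (A *ᵥ x + B *ᵥ u) = ((Aᵀ * M * A) *ᵥ x) ⬝ᵥ x
        + 2 * (((Bᵀ * M * A) *ᵥ x) ⬝ᵥ u) + ((Bᵀ * M * B) *ᵥ u) ⬝ᵥ u := by
    intro M A B hM
    have b1 : (M *ᵥ (B *ᵥ u)) ⬝ᵥ (A *ᵥ x) = (M *ᵥ (A *ᵥ x)) ⬝ᵥ (B *ᵥ u) := by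
      rw [mulVec_dotProduct_comm, hM.eq]
    rw [mulVec_add, add_dotProduct, dotProduct_add, dotProduct_add, b1,
      dotProduct_mulVec_transpose A, dotProduct_mulVec_transpose B,
      dotProduct_mulVec_transpose B]
    simp only [mulVec_mulVec, Matrix.mul_assoc]
    ring
  rw [e1, cross V A B hV, cross P C D hP, hY, hH]
  simp only [blockForm, add_mulVec, sub_mulVec, add_dotProduct, sub_dotProduct]
  rw [← e2]
  ring

theorem exists_mulVec_dotProduct_self_le (M : Matrix (Fin p) (Fin q) ℝ) :
    ∃ K : ℝ, 0 ≤ K ∧ ∀ v : Fin q → ℝ, (M *ᵥ v) ⬝ᵥ (M *ᵥ v) ≤ K * (v ⬝ᵥ v) := by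
  -- The squared Frobenius norm, by Cauchy-Schwarz in each row.
  refine ⟨∑ i, ∑ j, M i j ^ 2, by positivity, fun v => ?_⟩
  rw [Finset.sum_mul]
  refine Finset.sum_le_sum fun i _ => ?_
  have := Finset.sum_mul_sq_le_sq_mul_sq Finset.univ (M i) v
  simpa [mulVec, dotProduct, sq] using this

theorem dotProduct_self_nonneg (v : Fin p → ℝ) : 0 ≤ v ⬝ᵥ v :=
  Finset.sum_nonneg fun _ _ => mul_self_nonneg _

theorem add_dotProduct_add_self_le (v w : Fin p → ℝ) :
    (v + w) ⬝ᵥ (v + w) ≤ 2 * (v ⬝ᵥ v) + 2 * (w ⬝ᵥ w) := by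
  have h := dotProduct_self_nonneg (v - w)
  simp only [add_dotProduct, dotProduct_add, sub_dotProduct, dotProduct_sub] at h ⊢
  linarith

theorem posSemidef_sub_smul_one_iff {M : Matrix (Fin p) (Fin p) ℝ} (hM : M.IsSymm) (α : ℝ) :
    (M - α • (1 : Matrix (Fin p) (Fin p) ℝ)).PosSemidef ↔
      ∀ v : Fin p → ℝ, α * (v ⬝ᵥ v) ≤ (M *ᵥ v) ⬝ᵥ v := by
  rw [posSemidef_iff_dotProduct_mulVec]
  have hH : (M - α • (1 : Matrix (Fin p) (Fin p) ℝ)).IsHermitian := by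
    simp [Matrix.IsHermitian, conjTranspose_eq_transpose_of_trivial, hM.eq]
  have key : ∀ v : Fin p → ℝ, star v ⬝ᵥ ((M - α • (1 : Matrix (Fin p) (Fin p) ℝ)) *ᵥ v)
      = (M *ᵥ v) ⬝ᵥ v - α * (v ⬝ᵥ v) := by
    intro v
    rw [sub_mulVec, smul_mulVec, one_mulVec, dotProduct_sub, dotProduct_smul, star_trivial,
      dotProduct_comm v (M *ᵥ v), smul_eq_mul]
  simp only [key, sub_nonneg, and_iff_right hH]

theorem isUnit_of_posSemidef_sub_smul_one {M : Matrix (Fin p) (Fin p) ℝ} {α : ℝ} (hα : 0 < α)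
    (h : (M - α • (1 : Matrix (Fin p) (Fin p) ℝ)).PosSemidef) : IsUnit M := by
  have h1 : (α • (1 : Matrix (Fin p) (Fin p) ℝ)).PosDef := PosDef.one.smul hα
  have := h1.add_posSemidef h
  rw [add_sub_cancel] at this
  exact this.isUnit

theorem isMoorePenrose_nonsing_inv {M : Matrix (Fin p) (Fin p) ℝ} (hM : IsUnit M) :
    IsMoorePenrose M M⁻¹ := by
  have hd := (isUnit_iff_isUnit_det _).1 hM
  constructor <;> simp [mul_nonsing_inv _ hd, nonsing_inv_mul _ hd]

end LinearAlgebra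

/-! ### Scalar martingale-difference noise against past-measurable factors -/

section Noise

variable {Ω : Type*} {𝓕 mΩ : MeasurableSpace Ω} {μ : Measure Ω} [IsProbabilityMeasure μ]
  {w f : Ω → ℝ}

/-- The measure with density `w²` agrees with `μ` on `𝓕`. Working with nonnegative integrals avoids
assuming that the product is integrable, which pulling a factor out of a conditional expectation
requires and which is the very thing to be derived for `w * f`. -/
theorem lintegral_sq_mul (hF : 𝓕 ≤ mΩ) (hw : Measurable w) (hw2 : MemLp w 2 μ)
    (h1 : μ[fun s => w s ^ 2 | 𝓕] =ᵐ[μ] fun _ => 1) {φ : Ω → ENNReal} (hφ : Measurable[𝓕] φ) :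
    ∫⁻ s, ENNReal.ofReal (w s ^ 2) * φ s ∂μ = ∫⁻ s, φ s ∂μ := by
  have hwm : Measurable fun s => ENNReal.ofReal (w s ^ 2) := by fun_prop
  have htrim : (μ.withDensity fun s => ENNReal.ofReal (w s ^ 2)).trim hF = μ.trim hF := by
    refine @Measure.ext Ω 𝓕 _ _ fun A hA => ?_
    rw [trim_measurableSet_eq hF hA, trim_measurableSet_eq hF hA,
      withDensity_apply _ (hF A hA),
      ← ofReal_integral_eq_lintegral_ofReal hw2.integrable_sq.integrableOn
        (ae_of_all _ fun s => sq_nonneg _),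
      ← setIntegral_condExp hF hw2.integrable_sq hA,
      setIntegral_congr_ae (g := fun _ => (1 : ℝ)) (hF A hA) (h1.mono fun _ hs _ => hs)]
    simp
  have := lintegral_withDensity_eq_lintegral_mul μ hwm (hφ.mono hF le_rfl)
  rw [show (∫⁻ s, ENNReal.ofReal (w s ^ 2) * φ s ∂μ) = _ from this.symm,
    ← lintegral_trim hF hφ, htrim, lintegral_trim hF hφ]

theorem memLp_two_noise_mul (hF : 𝓕 ≤ mΩ) (hw : Measurable w) (hw2 : MemLp w 2 μ)
    (h1 : μ[fun s => w s ^ 2 | 𝓕] =ᵐ[μ] fun _ => 1)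
    (hf : Measurable[𝓕] f) (hf2 : MemLp f 2 μ) : MemLp (fun s => w s * f s) 2 μ := by
  have hfm : Measurable f := hf.mono hF le_rfl
  have hwf : Measurable fun s => w s * f s := hw.mul hfm
  rw [memLp_two_iff_integrable_sq hwf.aestronglyMeasurable]
  refine ⟨by fun_prop, ?_⟩
  have hi := hf2.integrable_sq.2
  rw [hasFiniteIntegral_iff_ofReal (ae_of_all _ fun s => sq_nonneg _)] at hi ⊢
  rw [← lintegral_sq_mul hF hw hw2 h1 (φ := fun s => ENNReal.ofReal (f s ^ 2))
    (by exact ENNReal.measurable_ofReal.comp (hf.pow_const 2))] at hi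
  simpa only [mul_pow, ENNReal.ofReal_mul (sq_nonneg _)] using hi

theorem integral_noise_mul (hF : 𝓕 ≤ mΩ) (hw2 : MemLp w 2 μ)
    (h0 : μ[w | 𝓕] =ᵐ[μ] fun _ => 0) (hf : Measurable[𝓕] f)
    (hi : Integrable (fun s => w s * f s) μ) : ∫ s, w s * f s ∂μ = 0 := by
  have hwi : Integrable w μ := hw2.integrable one_le_two
  rw [← integral_condExp hF]
  have := condExp_mul_of_stronglyMeasurable_right (m := 𝓕) hf.stronglyMeasurable hi hwi
  rw [integral_congr_ae (g := fun _ => (0 : ℝ)), integral_zero]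
  filter_upwards [this, h0] with s h1 h2
  change (μ[w * f | 𝓕]) s = 0
  rw [h1, Pi.mul_apply, h2, zero_mul]

theorem integral_noise_sq_mul (hF : 𝓕 ≤ mΩ) (hw2 : MemLp w 2 μ)
    (h1 : μ[fun s => w s ^ 2 | 𝓕] =ᵐ[μ] fun _ => 1) (hf : Measurable[𝓕] f)
    (hi : Integrable (fun s => w s ^ 2 * f s) μ) :
    ∫ s, w s ^ 2 * f s ∂μ = ∫ s, f s ∂μ := by
  rw [← integral_condExp hF]
  have := condExp_mul_of_stronglyMeasurable_right (m := 𝓕) hf.stronglyMeasurable hi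
    hw2.integrable_sq
  refine integral_congr_ae ?_
  filter_upwards [this, h1] with s h2 h3
  change (μ[(fun s => w s ^ 2) * f | 𝓕]) s = f s
  rw [h2, Pi.mul_apply, h3, one_mul]

end Noise

/-! ### Vector-valued second moments and orthogonality of the noise -/

section Vector

variable {Ω : Type*} {𝓕 mΩ : MeasurableSpace Ω} {μ : Measure Ω} {p q : ℕ}

theorem _root_.MeasureTheory.MemLp.mulVec {f : Ω → Fin q → ℝ} (hf : MemLp f 2 μ)
    (M : Matrix (Fin p) (Fin q) ℝ) : MemLp (fun s => M *ᵥ f s) 2 μ :=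
  (LinearMap.toContinuousLinearMap M.mulVecLin).comp_memLp' hf

theorem integrable_dotProduct {f g : Ω → Fin p → ℝ} (hf : MemLp f 2 μ) (hg : MemLp g 2 μ) :
    Integrable (fun s => f s ⬝ᵥ g s) μ :=
  integrable_finsetSum _ fun i _ => (hf.eval i).integrable_mul (hg.eval i)

theorem integral_mulVec {f : Ω → Fin q → ℝ} (hf : Integrable f μ)
    (M : Matrix (Fin p) (Fin q) ℝ) : ∫ s, M *ᵥ f s ∂μ = M *ᵥ ∫ s, f s ∂μ :=
  (LinearMap.toContinuousLinearMap M.mulVecLin).integral_comp_comm hf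

theorem integral_dotProduct_const {f : Ω → Fin p → ℝ} (hf : Integrable f μ) (v : Fin p → ℝ) :
    ∫ s, f s ⬝ᵥ v ∂μ = (∫ s, f s ∂μ) ⬝ᵥ v := by
  simp only [dotProduct]
  rw [integral_finsetSum _ fun i _ => (hf.eval i).mul_const _]
  exact Finset.sum_congr rfl fun i _ => by
    rw [integral_mul_const, eval_integral fun j => hf.eval j]

theorem _root_.Measurable.mulVec_const {f : Ω → Fin q → ℝ} (hf : Measurable[𝓕] f)
    (M : Matrix (Fin p) (Fin q) ℝ) : Measurable[𝓕] fun s => M *ᵥ f s :=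
  (LinearMap.toContinuousLinearMap M.mulVecLin).continuous.measurable.comp hf

theorem measurable_dotProduct {f g : Ω → Fin p → ℝ} (hf : Measurable[𝓕] f)
    (hg : Measurable[𝓕] g) : Measurable[𝓕] fun s => f s ⬝ᵥ g s :=
  Finset.measurable_fun_sum _ fun i _ =>
    ((measurable_pi_apply i).comp hf).mul ((measurable_pi_apply i).comp hg)

variable [IsProbabilityMeasure μ]

theorem integral_dotProduct_centered {f g : Ω → Fin p → ℝ} (hf : MemLp f 2 μ)
    (hg : MemLp g 2 μ) :
    ∫ s, f s ⬝ᵥ g s ∂μ = ∫ s, (f s - ∫ t, f t ∂μ) ⬝ᵥ (g s - ∫ t, g t ∂μ) ∂μ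
      + (∫ t, f t ∂μ) ⬝ᵥ ∫ t, g t ∂μ := by
  have hf1 := hf.integrable one_le_two
  have hg1 := hg.integrable one_le_two
  set a := ∫ t, f t ∂μ
  set b := ∫ t, g t ∂μ
  have hfa : MemLp (fun s => f s - a) 2 μ := hf.sub (memLp_const a)
  have hgb : MemLp (fun s => g s - b) 2 μ := hg.sub (memLp_const b)
  have h1 : ∀ s, f s ⬝ᵥ g s = (f s - a) ⬝ᵥ (g s - b) + (f s ⬝ᵥ b + (g s - b) ⬝ᵥ a) := by
    intro s
    simp only [sub_dotProduct, dotProduct_sub, dotProduct_comm (g s) a, dotProduct_comm b a]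
    ring
  have i1 := integrable_dotProduct hf (memLp_const b)
  have i2 := integrable_dotProduct hgb (memLp_const a)
  rw [integral_congr_ae (ae_of_all _ h1), integral_add (integrable_dotProduct hfa hgb),
    integral_add i1 i2, integral_dotProduct_const hf1,
    integral_dotProduct_const (hgb.integrable one_le_two), integral_sub hg1 (by fun_prop)]
  · simp [b, a]
  · exact i1.add i2

variable {w : Ω → ℝ} {Y Z : Ω → Fin p → ℝ}

theorem memLp_two_noise_smul (hF : 𝓕 ≤ mΩ) (hw : Measurable w) (hw2 : MemLp w 2 μ)
    (h1 : μ[fun s => w s ^ 2 | 𝓕] =ᵐ[μ] fun _ => 1)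
    (hZ : Measurable[𝓕] Z) (hZ2 : MemLp Z 2 μ) : MemLp (fun s => w s • Z s) 2 μ :=
  MemLp.of_eval fun i => memLp_two_noise_mul hF hw hw2 h1
    ((measurable_pi_apply i).comp hZ) (hZ2.eval i)

theorem integral_noise_smul (hF : 𝓕 ≤ mΩ) (hw : Measurable w) (hw2 : MemLp w 2 μ)
    (h0 : μ[w | 𝓕] =ᵐ[μ] fun _ => 0)
    (h1 : μ[fun s => w s ^ 2 | 𝓕] =ᵐ[μ] fun _ => 1)
    (hZ : Measurable[𝓕] Z) (hZ2 : MemLp Z 2 μ) : ∫ s, w s • Z s ∂μ = 0 := by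
  have hi := (memLp_two_noise_smul hF hw hw2 h1 hZ hZ2).integrable one_le_two
  ext i
  rw [eval_integral fun j => hi.eval j]
  exact integral_noise_mul hF hw2 h0 ((measurable_pi_apply i).comp hZ) (hi.eval i)

theorem integral_add_noise_smul (hF : 𝓕 ≤ mΩ) (hw : Measurable w) (hw2 : MemLp w 2 μ)
    (h0 : μ[w | 𝓕] =ᵐ[μ] fun _ => 0)
    (h1 : μ[fun s => w s ^ 2 | 𝓕] =ᵐ[μ] fun _ => 1)
    (hY2 : MemLp Y 2 μ) (hZ : Measurable[𝓕] Z) (hZ2 : MemLp Z 2 μ) :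
    ∫ s, (Y s + w s • Z s) ∂μ = ∫ s, Y s ∂μ := by
  rw [integral_add (hY2.integrable one_le_two)
    ((memLp_two_noise_smul hF hw hw2 h1 hZ hZ2).integrable one_le_two),
    integral_noise_smul hF hw hw2 h0 h1 hZ hZ2, add_zero]

/-- The cross terms are linear in `w` with `𝓕`-measurable factor and vanish; in the last term `w²`
averages to one given `𝓕`. -/
theorem integral_quadratic_add_noise_smul (hF : 𝓕 ≤ mΩ) (hw : Measurable w)
    (hw2 : MemLp w 2 μ) (h0 : μ[w | 𝓕] =ᵐ[μ] fun _ => 0)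
    (h1 : μ[fun s => w s ^ 2 | 𝓕] =ᵐ[μ] fun _ => 1)
    (hY : Measurable[𝓕] Y) (hY2 : MemLp Y 2 μ) (hZ : Measurable[𝓕] Z) (hZ2 : MemLp Z 2 μ)
    (M : Matrix (Fin p) (Fin p) ℝ) :
    ∫ s, (M *ᵥ (Y s + w s • Z s)) ⬝ᵥ (Y s + w s • Z s) ∂μ
      = ∫ s, (M *ᵥ Y s) ⬝ᵥ Y s ∂μ + ∫ s, (M *ᵥ Z s) ⬝ᵥ Z s ∂μ := by
  have hwZ := memLp_two_noise_smul hF hw hw2 h1 hZ hZ2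
  have e : ∀ s, (M *ᵥ (Y s + w s • Z s)) ⬝ᵥ (Y s + w s • Z s) = (M *ᵥ Y s) ⬝ᵥ Y s
      + (w s * ((M *ᵥ Y s) ⬝ᵥ Z s + (M *ᵥ Z s) ⬝ᵥ Y s) + w s ^ 2 * ((M *ᵥ Z s) ⬝ᵥ Z s)) := by
    intro s
    simp only [mulVec_add, mulVec_smul, add_dotProduct, dotProduct_add, smul_dotProduct,
      dotProduct_smul, smul_eq_mul]
    ring
  have i1 := integrable_dotProduct (hY2.mulVec M) hY2
  -- The factor of `w` is only integrable, so `w` is grouped with `Z`: `w Z` is square integrable.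
  have i2 : Integrable (fun s => w s * ((M *ᵥ Y s) ⬝ᵥ Z s + (M *ᵥ Z s) ⬝ᵥ Y s)) μ := by
    refine ((integrable_dotProduct (hY2.mulVec M) hwZ).add
      (integrable_dotProduct (hwZ.mulVec M) hY2)).congr (ae_of_all _ fun s => ?_)
    simp only [Pi.add_apply, mulVec_smul, smul_dotProduct, dotProduct_smul, smul_eq_mul]
    ring
  have i3 : Integrable (fun s => w s ^ 2 * ((M *ᵥ Z s) ⬝ᵥ Z s)) μ := by
    refine (integrable_dotProduct (hwZ.mulVec M) hwZ).congr (ae_of_all _ fun s => ?_)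
    simp only [mulVec_smul, smul_dotProduct, dotProduct_smul, smul_eq_mul]
    ring
  have hm : Measurable[𝓕] fun s => (M *ᵥ Y s) ⬝ᵥ Z s + (M *ᵥ Z s) ⬝ᵥ Y s :=
    (measurable_dotProduct (hY.mulVec_const M) hZ).add
      (measurable_dotProduct (hZ.mulVec_const M) hY)
  have i23 : Integrable (fun s => w s * ((M *ᵥ Y s) ⬝ᵥ Z s + (M *ᵥ Z s) ⬝ᵥ Y s)
      + w s ^ 2 * ((M *ᵥ Z s) ⬝ᵥ Z s)) μ := i2.add i3
  rw [integral_congr_ae (ae_of_all _ e), integral_add i1 i23, integral_add i2 i3,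
    integral_noise_mul hF hw2 h0 hm i2,
    integral_noise_sq_mul hF hw2 h1 (measurable_dotProduct (hZ.mulVec_const M) hZ) i3, zero_add]

end Vector

/-- The Riccati recursion, written with the matrix inverse (which is zero for a singular matrix)
in place of the pseudoinverse. -/
structure SolvesInverseRiccati {n m : ℕ} (c : Coeffs n m) (N : ℕ)
    (P V : ℕ → Matrix (Fin n) (Fin n) ℝ) : Prop where
  terminal_P : P N = c.G
  terminal_V : V N = c.G + c.Gbar
  step_P : ∀ k < N, P k = c.Q k + (c.A k)ᵀ * P (k + 1) * c.A k
    + (c.C k)ᵀ * P (k + 1) * c.C k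
    - (c.H k (P (k + 1)))ᵀ * (c.Upsilon k (P (k + 1)))⁻¹ * c.H k (P (k + 1))
  step_V : ∀ k < N, V k = c.Q k + c.Qbar k
    + (c.A k + c.Abar k)ᵀ * V (k + 1) * (c.A k + c.Abar k)
    + (c.C k + c.Cbar k)ᵀ * P (k + 1) * (c.C k + c.Cbar k)
    - (c.HBar k (P (k + 1)) (V (k + 1)))ᵀ * (c.UpsilonBar k (P (k + 1)) (V (k + 1)))⁻¹
      * c.HBar k (P (k + 1)) (V (k + 1))

/-! ### The Riccati recursion with inverses: symmetry, existence, comparison with the pseudoinverse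
-/

section Riccati

variable {n m N : ℕ} {c : Coeffs n m} {P V : ℕ → Matrix (Fin n) (Fin n) ℝ}

theorem IsSymm.congruence {p q : ℕ} {M : Matrix (Fin p) (Fin p) ℝ} (hM : M.IsSymm)
    (B : Matrix (Fin p) (Fin q) ℝ) : (Bᵀ * M * B).IsSymm := by
  simp [Matrix.IsSymm, transpose_mul, hM.eq, Matrix.mul_assoc]

theorem IsSymm.nonsing_inv {p : ℕ} {M : Matrix (Fin p) (Fin p) ℝ} (hM : M.IsSymm) :
    M⁻¹.IsSymm := by
  rw [Matrix.IsSymm, transpose_nonsing_inv, hM.eq]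

theorem Coeffs.SymmetricWeights.upsilon_isSymm (hc : c.SymmetricWeights N) {k : ℕ} (hk : k < N)
    {X : Matrix (Fin n) (Fin n) ℝ} (hX : X.IsSymm) : (c.Upsilon k X).IsSymm :=
  ((hc.R k hk).add (IsSymm.congruence hX _)).add (IsSymm.congruence hX _)

theorem Coeffs.SymmetricWeights.upsilonBar_isSymm (hc : c.SymmetricWeights N) {k : ℕ}
    (hk : k < N) {X Y : Matrix (Fin n) (Fin n) ℝ} (hX : X.IsSymm) (hY : Y.IsSymm) :
    (c.UpsilonBar k X Y).IsSymm :=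
  (((hc.R k hk).add (hc.Rbar k hk)).add (IsSymm.congruence hY _)).add (IsSymm.congruence hX _)

theorem SolvesInverseRiccati.isSymm (h : SolvesInverseRiccati c N P V)
    (hc : c.SymmetricWeights N) {k : ℕ} (hk : k ≤ N) : (P k).IsSymm ∧ (V k).IsSymm := by
  induction hk using Nat.decreasingInduction with
  | self => exact ⟨h.terminal_P ▸ hc.G, h.terminal_V ▸ hc.G.add hc.Gbar⟩
  | of_succ k hk ih =>
    rw [h.step_P k hk, h.step_V k hk]
    refine ⟨?_, ?_⟩
    · exact (((hc.Q k hk).add (IsSymm.congruence ih.1 _)).add (IsSymm.congruence ih.1 _)).sub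
        (IsSymm.congruence (IsSymm.nonsing_inv (hc.upsilon_isSymm hk ih.1)) _)
    · exact ((((hc.Q k hk).add (hc.Qbar k hk)).add (IsSymm.congruence ih.2 _)).add
        (IsSymm.congruence ih.1 _)).sub
        (IsSymm.congruence (IsSymm.nonsing_inv (hc.upsilonBar_isSymm hk ih.1 ih.2)) _)

/-- Strong regularity makes `Υ_k` and `Ῡ_k` invertible, and the pseudoinverse of an invertible
matrix is its inverse by uniqueness. -/
theorem IsRiccatiSolution.solvesInverseRiccati (h : IsRiccatiSolution c N P V)
    (hr : IsStronglyRegular c N P V) : SolvesInverseRiccati c N P V := by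
  obtain ⟨α, hα, hr⟩ := hr
  refine ⟨h.terminal_P, h.terminal_V, fun k hk => ?_, fun k hk => ?_⟩
  · obtain ⟨X, hX, e⟩ := h.step_P k hk
    rwa [hX.unique (isMoorePenrose_nonsing_inv
      (isUnit_of_posSemidef_sub_smul_one hα (hr k hk).1))] at e
  · obtain ⟨X, hX, e⟩ := h.step_V k hk
    rwa [hX.unique (isMoorePenrose_nonsing_inv
      (isUnit_of_posSemidef_sub_smul_one hα (hr k hk).2))] at e

theorem SolvesInverseRiccati.isRiccatiSolution (h : SolvesInverseRiccati c N P V)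
    (hr : IsStronglyRegular c N P V) : IsRiccatiSolution c N P V := by
  obtain ⟨α, hα, hr⟩ := hr
  exact ⟨h.terminal_P, h.terminal_V,
    fun k hk => ⟨_, isMoorePenrose_nonsing_inv
      (isUnit_of_posSemidef_sub_smul_one hα (hr k hk).1), h.step_P k hk⟩,
    fun k hk => ⟨_, isMoorePenrose_nonsing_inv
      (isUnit_of_posSemidef_sub_smul_one hα (hr k hk).2), h.step_V k hk⟩⟩

/-- One backward step of the Riccati recursion. -/
noncomputable def Coeffs.riccatiStep (c : Coeffs n m) (k : ℕ)
    (X : Matrix (Fin n) (Fin n) ℝ × Matrix (Fin n) (Fin n) ℝ) :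
    Matrix (Fin n) (Fin n) ℝ × Matrix (Fin n) (Fin n) ℝ :=
  (c.Q k + (c.A k)ᵀ * X.1 * c.A k + (c.C k)ᵀ * X.1 * c.C k
      - (c.H k X.1)ᵀ * (c.Upsilon k X.1)⁻¹ * c.H k X.1,
    c.Q k + c.Qbar k + (c.A k + c.Abar k)ᵀ * X.2 * (c.A k + c.Abar k)
      + (c.C k + c.Cbar k)ᵀ * X.1 * (c.C k + c.Cbar k)
      - (c.HBar k X.1 X.2)ᵀ * (c.UpsilonBar k X.1 X.2)⁻¹ * c.HBar k X.1 X.2)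

/-- The solution of the Riccati recursion `j` steps before the terminal time `N`. -/
noncomputable def Coeffs.riccatiBackward (c : Coeffs n m) (N : ℕ) :
    ℕ → Matrix (Fin n) (Fin n) ℝ × Matrix (Fin n) (Fin n) ℝ
  | 0 => (c.G, c.G + c.Gbar)
  | j + 1 => c.riccatiStep (N - (j + 1)) (c.riccatiBackward N j)

/-- The matrix inverse is total, so the backward recursion never breaks down and solvability costs
nothing; only regularity remains to be proved. -/
theorem exists_solvesInverseRiccati (c : Coeffs n m) (N : ℕ) :
    ∃ P V, SolvesInverseRiccati c N P V := by
  have key : ∀ k < N, c.riccatiBackward N (N - k)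
      = c.riccatiStep k (c.riccatiBackward N (N - (k + 1))) := by
    intro k hk
    -- `riccatiBackward` counts steps from the horizon; for `k < N` the truncated subtractions
    -- invert each other.
    rw [show N - k = N - (k + 1) + 1 by omega, Coeffs.riccatiBackward,
      show N - (N - (k + 1) + 1) = k by omega]
  refine ⟨fun k => (c.riccatiBackward N (N - k)).1, fun k => (c.riccatiBackward N (N - k)).2,
    by simp [Coeffs.riccatiBackward], by simp [Coeffs.riccatiBackward], fun k hk => ?_,
    fun k hk => ?_⟩
  · exact congrArg Prod.fst (key k hk)
  · exact congrArg Prod.snd (key k hk)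

end Riccati

/-! ### State dynamics: adaptedness, means and fluctuations -/

section Dynamics

variable {n m N : ℕ} {Ω : Type*} {𝓕 mΩ : MeasurableSpace Ω} {μ : Measure Ω}
  {ξ : Ω → Fin n → ℝ} {ω : ℕ → Ω → ℝ} {c : Coeffs n m}

theorem info_mono (ξ : Ω → Fin n → ℝ) (ω : ℕ → Ω → ℝ) {a b : ℕ} (h : a ≤ b) :
    info ξ ω a ≤ info ξ ω b := by
  unfold info
  refine sup_le_sup le_rfl (iSup_mono fun j => iSup_mono' fun hj => ⟨hj.trans_le h, le_rfl⟩)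

theorem info_le (hξ : Measurable ξ) (hω : IsNoise μ ξ ω N) {k : ℕ} (hk : k ≤ N) :
    info ξ ω k ≤ mΩ :=
  sup_le hξ.comap_le (iSup₂_le fun j hj => (hω.measurable j (hj.trans_le hk)).comap_le)

theorem measurable_noise_info (ξ : Ω → Fin n → ℝ) (ω : ℕ → Ω → ℝ) (k : ℕ) :
    Measurable[info ξ ω (k + 1)] (ω k) :=
  (comap_measurable (ω k)).mono
    (le_sup_of_le_right (le_iSup₂_of_le k (Nat.lt_succ_self k) le_rfl)) le_rfl

/-- Measurable with respect to a sub-σ-algebra and square integrable. -/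
def SqIntegrable {Ω : Type*} {mΩ : MeasurableSpace Ω} {p : ℕ} (𝓕 : MeasurableSpace Ω)
    (μ : Measure[mΩ] Ω) (f : Ω → Fin p → ℝ) : Prop :=
  Measurable[𝓕] f ∧ MemLp f 2 μ

namespace SqIntegrable

variable {p q : ℕ} {f g : Ω → Fin p → ℝ}

theorem add (hf : SqIntegrable 𝓕 μ f) (hg : SqIntegrable 𝓕 μ g) :
    SqIntegrable 𝓕 μ fun s => f s + g s :=
  ⟨hf.1.fun_add hg.1, hf.2.add hg.2⟩

theorem sub (hf : SqIntegrable 𝓕 μ f) (hg : SqIntegrable 𝓕 μ g) :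
    SqIntegrable 𝓕 μ fun s => f s - g s :=
  ⟨hf.1.fun_sub hg.1, hf.2.sub hg.2⟩

theorem neg (hf : SqIntegrable 𝓕 μ f) : SqIntegrable 𝓕 μ fun s => -f s :=
  ⟨@Measurable.neg _ _ _ _ _ 𝓕 _ hf.1, hf.2.neg⟩

theorem mulVec (hf : SqIntegrable 𝓕 μ f) (M : Matrix (Fin q) (Fin p) ℝ) :
    SqIntegrable 𝓕 μ fun s => M *ᵥ f s :=
  ⟨hf.1.mulVec_const M, hf.2.mulVec M⟩

theorem mono {𝓖 : MeasurableSpace Ω} (hf : SqIntegrable 𝓕 μ f) (h : 𝓕 ≤ 𝓖) :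
    SqIntegrable 𝓖 μ f :=
  ⟨hf.1.mono h le_rfl, hf.2⟩

theorem const [IsProbabilityMeasure μ] (v : Fin p → ℝ) : SqIntegrable 𝓕 μ fun _ : Ω => v :=
  ⟨measurable_const, memLp_const v⟩

theorem integrable [IsProbabilityMeasure μ] (hf : SqIntegrable 𝓕 μ f) : Integrable f μ :=
  hf.2.integrable one_le_two

end SqIntegrable

/-- The part of the next state that does not involve the noise. -/
noncomputable def drift (c : Coeffs n m) (μ : Measure Ω) (k : ℕ) (x : Ω → Fin n → ℝ)
    (u : Ω → Fin m → ℝ) (s : Ω) : Fin n → ℝ :=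
  c.A k *ᵥ x s + c.Abar k *ᵥ (∫ t, x t ∂μ) + c.B k *ᵥ u s + c.Bbar k *ᵥ (∫ t, u t ∂μ)

/-- The factor of the noise in the next state. -/
noncomputable def diffusion (c : Coeffs n m) (μ : Measure Ω) (k : ℕ) (x : Ω → Fin n → ℝ)
    (u : Ω → Fin m → ℝ) (s : Ω) : Fin n → ℝ :=
  c.C k *ᵥ x s + c.Cbar k *ᵥ (∫ t, x t ∂μ) + c.D k *ᵥ u s + c.Dbar k *ᵥ (∫ t, u t ∂μ)

/-- The next state. -/
noncomputable def nextState (c : Coeffs n m) (μ : Measure Ω) (ω : ℕ → Ω → ℝ) (k : ℕ)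
    (x : Ω → Fin n → ℝ) (u : Ω → Fin m → ℝ) (s : Ω) : Fin n → ℝ :=
  drift c μ k x u s + ω k s • diffusion c μ k x u s

theorem state_succ (c : Coeffs n m) (μ : Measure Ω) (ω : ℕ → Ω → ℝ) (x₀ : Ω → Fin n → ℝ)
    (u : ℕ → Ω → Fin m → ℝ) (k : ℕ) :
    state c μ ω x₀ u (k + 1) = nextState c μ ω k (state c μ ω x₀ u k) (u k) := rfl

section Probability

variable [IsProbabilityMeasure μ] {x : Ω → Fin n → ℝ} {u : Ω → Fin m → ℝ} {k : ℕ}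

theorem SqIntegrable.drift (hx : SqIntegrable 𝓕 μ x) (hu : SqIntegrable 𝓕 μ u) :
    SqIntegrable 𝓕 μ (drift c μ k x u) :=
  (((hx.mulVec _).add (.const _)).add (hu.mulVec _)).add (.const _)

theorem SqIntegrable.diffusion (hx : SqIntegrable 𝓕 μ x) (hu : SqIntegrable 𝓕 μ u) :
    SqIntegrable 𝓕 μ (diffusion c μ k x u) :=
  (((hx.mulVec _).add (.const _)).add (hu.mulVec _)).add (.const _)

theorem SqIntegrable.nextState (hξ : Measurable ξ) (hω : IsNoise μ ξ ω N) (hk : k < N)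
    (hx : SqIntegrable (info ξ ω k) μ x) (hu : SqIntegrable (info ξ ω k) μ u) :
    SqIntegrable (info ξ ω (k + 1)) μ (nextState c μ ω k x u) := by
  have hY := (hx.drift hu (c := c) (k := k)).mono (info_mono ξ ω k.le_succ)
  have hZ := hx.diffusion hu (c := c) (k := k)
  refine hY.add ⟨?_, memLp_two_noise_smul (info_le hξ hω hk.le) (hω.measurable k hk)
    (hω.memLp k hk) (hω.condExp_sq_eq_one k hk) hZ.1 hZ.2⟩
  exact (measurable_noise_info ξ ω k).fun_smul (hZ.1.mono (info_mono ξ ω k.le_succ) le_rfl)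

theorem sqIntegrable_state (hξ : Measurable ξ) (hω : IsNoise μ ξ ω N)
    {u : ℕ → Ω → Fin m → ℝ} {k : ℕ} (hk : k ≤ N)
    (hu : ∀ j < k, SqIntegrable (info ξ ω j) μ (u j)) :
    SqIntegrable (info ξ ω k) μ (state c μ ω (fun _ => 0) u k) := by
  induction k with
  | zero => exact .const 0
  | succ k ih =>
    exact (ih (by omega) fun j hj => hu j (by omega)).nextState hξ hω hk (hu k k.lt_succ_self)

theorem integral_drift (hx : SqIntegrable 𝓕 μ x) (hu : SqIntegrable 𝓕 μ u) :
    ∫ s, drift c μ k x u s ∂μ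
      = (c.A k + c.Abar k) *ᵥ (∫ t, x t ∂μ) + (c.B k + c.Bbar k) *ᵥ (∫ t, u t ∂μ) := by
  have h1 := hx.mulVec (c.A k)
  have h2 := h1.add (.const (c.Abar k *ᵥ ∫ t, x t ∂μ))
  have h3 := h2.add (hu.mulVec (c.B k))
  simp only [drift]
  rw [integral_add h3.integrable (integrable_const _),
    integral_add h2.integrable (hu.mulVec (c.B k)).integrable,
    integral_add h1.integrable (integrable_const _), integral_mulVec hx.integrable,
    integral_mulVec hu.integrable]
  simp only [integral_const, probReal_univ, one_smul, add_mulVec]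
  abel

theorem integral_diffusion (hx : SqIntegrable 𝓕 μ x) (hu : SqIntegrable 𝓕 μ u) :
    ∫ s, diffusion c μ k x u s ∂μ
      = (c.C k + c.Cbar k) *ᵥ (∫ t, x t ∂μ) + (c.D k + c.Dbar k) *ᵥ (∫ t, u t ∂μ) := by
  have h1 := hx.mulVec (c.C k)
  have h2 := h1.add (.const (c.Cbar k *ᵥ ∫ t, x t ∂μ))
  have h3 := h2.add (hu.mulVec (c.D k))
  simp only [diffusion]
  rw [integral_add h3.integrable (integrable_const _),
    integral_add h2.integrable (hu.mulVec (c.D k)).integrable,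
    integral_add h1.integrable (integrable_const _), integral_mulVec hx.integrable,
    integral_mulVec hu.integrable]
  simp only [integral_const, probReal_univ, one_smul, add_mulVec]
  abel

theorem drift_sub_integral (hx : SqIntegrable 𝓕 μ x) (hu : SqIntegrable 𝓕 μ u) (s : Ω) :
    drift c μ k x u s - ∫ t, drift c μ k x u t ∂μ
      = c.A k *ᵥ (x s - ∫ t, x t ∂μ) + c.B k *ᵥ (u s - ∫ t, u t ∂μ) := by
  rw [integral_drift hx hu]
  simp only [drift, add_mulVec, mulVec_sub]
  abel

theorem diffusion_sub_integral (hx : SqIntegrable 𝓕 μ x) (hu : SqIntegrable 𝓕 μ u) (s : Ω) :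
    diffusion c μ k x u s - ∫ t, diffusion c μ k x u t ∂μ
      = c.C k *ᵥ (x s - ∫ t, x t ∂μ) + c.D k *ᵥ (u s - ∫ t, u t ∂μ) := by
  rw [integral_diffusion hx hu]
  simp only [diffusion, add_mulVec, mulVec_sub]
  abel

end Probability

/-- The quadratic form `P` of the fluctuation plus the quadratic form `V` of the mean. -/
noncomputable def meanFieldForm {p : ℕ} (μ : Measure Ω) (P V : Matrix (Fin p) (Fin p) ℝ)
    (f : Ω → Fin p → ℝ) : ℝ :=
  ∫ s, (P *ᵥ (f s - ∫ t, f t ∂μ)) ⬝ᵥ (f s - ∫ t, f t ∂μ) ∂μ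
    + (V *ᵥ ∫ t, f t ∂μ) ⬝ᵥ ∫ t, f t ∂μ

/-- The running cost at time `k`. -/
noncomputable def runningCost (c : Coeffs n m) (μ : Measure Ω) (k : ℕ) (x : Ω → Fin n → ℝ)
    (u : Ω → Fin m → ℝ) : ℝ :=
  ∫ s, blockForm (c.Q k) (c.S k) (c.R k) (x s) (u s) ∂μ
    + blockForm (c.Qbar k) (c.Sbar k) (c.Rbar k) (∫ t, x t ∂μ) (∫ t, u t ∂μ)

/-- The negative of the optimal feedback control at time `k`. -/
noncomputable def feedback (c : Coeffs n m) (μ : Measure Ω) (k : ℕ)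
    (P V : Matrix (Fin n) (Fin n) ℝ) (x : Ω → Fin n → ℝ) (s : Ω) : Fin m → ℝ :=
  (c.Upsilon k P)⁻¹ *ᵥ (c.H k P *ᵥ (x s - ∫ t, x t ∂μ))
    + (c.UpsilonBar k P V)⁻¹ *ᵥ (c.HBar k P V *ᵥ ∫ t, x t ∂μ)

theorem integrable_blockForm {x : Ω → Fin n → ℝ} {u : Ω → Fin m → ℝ}
    (hx : SqIntegrable 𝓕 μ x) (hu : SqIntegrable 𝓕 μ u)
    (Q : Matrix (Fin n) (Fin n) ℝ) (S : Matrix (Fin m) (Fin n) ℝ)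
    (R : Matrix (Fin m) (Fin m) ℝ) : Integrable (fun s => blockForm Q S R (x s) (u s)) μ :=
  (integrable_dotProduct ((hx.mulVec Q).add (hu.mulVec Sᵀ)).2 hx.2).add
    (integrable_dotProduct ((hx.mulVec S).add (hu.mulVec R)).2 hu.2)

/-! ### The cost as a sum of squares -/

section Probability

variable [IsProbabilityMeasure μ] {x : Ω → Fin n → ℝ} {u : Ω → Fin m → ℝ} {k p : ℕ}

theorem SqIntegrable.feedback (hx : SqIntegrable 𝓕 μ x) (P V : Matrix (Fin n) (Fin n) ℝ) :
    SqIntegrable 𝓕 μ (feedback c μ k P V x) :=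
  (((hx.sub (.const _)).mulVec _).mulVec _).add (.const _)

theorem integral_sub_integral {f : Ω → Fin p → ℝ} (hf : SqIntegrable 𝓕 μ f) :
    ∫ s, (f s - ∫ t, f t ∂μ) ∂μ = 0 := by
  rw [integral_sub hf.integrable (integrable_const _)]
  simp

theorem integral_add_feedback (hx : SqIntegrable 𝓕 μ x) (hu : SqIntegrable 𝓕 μ u)
    (P V : Matrix (Fin n) (Fin n) ℝ) :
    ∫ s, (u s + feedback c μ k P V x s) ∂μ = (∫ t, u t ∂μ)
      + (c.UpsilonBar k P V)⁻¹ *ᵥ (c.HBar k P V *ᵥ ∫ t, x t ∂μ) := by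
  have hx' : SqIntegrable 𝓕 μ fun s => x s - ∫ t, x t ∂μ := hx.sub (.const _)
  rw [integral_add hu.integrable (hx.feedback P V).integrable]
  simp only [feedback]
  rw [integral_add ((hx'.mulVec _).mulVec _).integrable (integrable_const _),
    integral_mulVec (hx'.mulVec _).integrable, integral_mulVec hx'.integrable,
    integral_sub_integral hx]
  simp

theorem integral_quadratic_eq_meanFieldForm {f : Ω → Fin p → ℝ} (hf : SqIntegrable 𝓕 μ f)
    (M : Matrix (Fin p) (Fin p) ℝ) :
    ∫ s, (M *ᵥ f s) ⬝ᵥ f s ∂μ = meanFieldForm μ M M f := by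
  rw [integral_dotProduct_centered (hf.mulVec M).2 hf.2, integral_mulVec hf.integrable,
    meanFieldForm]
  simp only [mulVec_sub]

theorem integral_blockForm_centered (hx : SqIntegrable 𝓕 μ x) (hu : SqIntegrable 𝓕 μ u)
    (Q : Matrix (Fin n) (Fin n) ℝ) (S : Matrix (Fin m) (Fin n) ℝ)
    (R : Matrix (Fin m) (Fin m) ℝ) :
    ∫ s, blockForm Q S R (x s) (u s) ∂μ
      = ∫ s, blockForm Q S R (x s - ∫ t, x t ∂μ) (u s - ∫ t, u t ∂μ) ∂μ
        + blockForm Q S R (∫ t, x t ∂μ) (∫ t, u t ∂μ) := by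
  have h1 := (hx.mulVec Q).add (hu.mulVec Sᵀ)
  have h2 := (hx.mulVec S).add (hu.mulVec R)
  have hx' : SqIntegrable 𝓕 μ fun s => x s - ∫ t, x t ∂μ := hx.sub (.const _)
  have hu' : SqIntegrable 𝓕 μ fun s => u s - ∫ t, u t ∂μ := hu.sub (.const _)
  simp only [blockForm]
  rw [integral_add (integrable_dotProduct h1.2 hx.2) (integrable_dotProduct h2.2 hu.2),
    integral_add (integrable_dotProduct ((hx'.mulVec Q).add (hu'.mulVec Sᵀ)).2 hx'.2)
      (integrable_dotProduct ((hx'.mulVec S).add (hu'.mulVec R)).2 hu'.2),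
    integral_dotProduct_centered h1.2 hx.2, integral_dotProduct_centered h2.2 hu.2,
    integral_add (hx.mulVec Q).integrable (hu.mulVec Sᵀ).integrable,
    integral_add (hx.mulVec S).integrable (hu.mulVec R).integrable,
    integral_mulVec hx.integrable, integral_mulVec hx.integrable, integral_mulVec hu.integrable,
    integral_mulVec hu.integrable]
  simp only [mulVec_sub, add_sub_add_comm]
  ring

theorem integral_nextState (hξ : Measurable ξ) (hω : IsNoise μ ξ ω N) (hk : k < N)
    (hx : SqIntegrable (info ξ ω k) μ x) (hu : SqIntegrable (info ξ ω k) μ u) :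
    ∫ s, nextState c μ ω k x u s ∂μ = ∫ s, drift c μ k x u s ∂μ :=
  integral_add_noise_smul (info_le hξ hω hk.le) (hω.measurable k hk) (hω.memLp k hk)
    (hω.condExp_eq_zero k hk) (hω.condExp_sq_eq_one k hk) (hx.drift hu).2 (hx.diffusion hu).1
    (hx.diffusion hu).2

/-- The noise leaves the mean unchanged and is orthogonal to the past, so the uncentered second
moment of the diffusion joins the fluctuation, and its mean too is weighted by `P`. -/
theorem meanFieldForm_nextState (hξ : Measurable ξ) (hω : IsNoise μ ξ ω N) (hk : k < N)
    (hx : SqIntegrable (info ξ ω k) μ x) (hu : SqIntegrable (info ξ ω k) μ u)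
    (P V : Matrix (Fin n) (Fin n) ℝ) :
    meanFieldForm μ P V (nextState c μ ω k x u)
      = meanFieldForm μ P V (drift c μ k x u) + meanFieldForm μ P P (diffusion c μ k x u) := by
  have hY : SqIntegrable (info ξ ω k) μ (drift c μ k x u) := hx.drift hu
  have hZ : SqIntegrable (info ξ ω k) μ (diffusion c μ k x u) := hx.diffusion hu
  have hY' : SqIntegrable (info ξ ω k) μ
    fun s => drift c μ k x u s - ∫ t, drift c μ k x u t ∂μ := hY.sub (.const _)
  rw [← integral_quadratic_eq_meanFieldForm hZ, meanFieldForm, meanFieldForm,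
    integral_nextState hξ hω hk hx hu]
  simp only [nextState, add_sub_right_comm]
  rw [integral_quadratic_add_noise_smul (info_le hξ hω hk.le) (hω.measurable k hk)
    (hω.memLp k hk) (hω.condExp_eq_zero k hk) (hω.condExp_sq_eq_one k hk) hY'.1 hY'.2 hZ.1 hZ.2]
  ring

/-- One step of dynamic programming: the Riccati equations are what the square completion leaves as
the form of the current state. -/
theorem meanFieldForm_nextState_add_runningCost (hc : c.SymmetricWeights N) (hξ : Measurable ξ)
    (hω : IsNoise μ ξ ω N) {P V : ℕ → Matrix (Fin n) (Fin n) ℝ}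
    (h : SolvesInverseRiccati c N P V) (hk : k < N)
    (hx : SqIntegrable (info ξ ω k) μ x) (hu : SqIntegrable (info ξ ω k) μ u)
    (hunit : (IsUnit (c.Upsilon k (P (k + 1))) ∧ IsUnit (c.UpsilonBar k (P (k + 1)) (V (k + 1))))
      ∨ x = fun _ => 0) :
    meanFieldForm μ (P (k + 1)) (V (k + 1)) (nextState c μ ω k x u) + runningCost c μ k x u
      = meanFieldForm μ (P k) (V k) x
        + meanFieldForm μ (c.Upsilon k (P (k + 1))) (c.UpsilonBar k (P (k + 1)) (V (k + 1)))
            (fun s => u s + feedback c μ k (P (k + 1)) (V (k + 1)) x s) := by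
  obtain ⟨hP, hV⟩ := h.isSymm hc (Nat.succ_le_of_lt hk)
  rw [meanFieldForm_nextState hξ hω hk hx hu, runningCost, integral_blockForm_centered hx hu]
  simp only [meanFieldForm, drift_sub_integral hx hu, diffusion_sub_integral hx hu]
  simp only [integral_add_feedback hx hu, integral_drift hx hu, integral_diffusion hx hu]
  rw [h.step_P k hk, h.step_V k hk]
  set a := ∫ t, x t ∂μ with ha
  set b := ∫ t, u t ∂μ with hb
  have hx' : SqIntegrable (info ξ ω k) μ fun s => x s - a := hx.sub (.const _)
  have hu' : SqIntegrable (info ξ ω k) μ fun s => u s - b := hu.sub (.const _)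
  have e1 : ∀ s, u s + feedback c μ k (P (k + 1)) (V (k + 1)) x s
      - (b + (c.UpsilonBar k (P (k + 1)) (V (k + 1)))⁻¹
        *ᵥ (c.HBar k (P (k + 1)) (V (k + 1)) *ᵥ a))
      = (u s - b) + (c.Upsilon k (P (k + 1)))⁻¹ *ᵥ (c.H k (P (k + 1)) *ᵥ (x s - a)) := by
    intro s
    simp only [feedback, ← ha]
    abel
  simp only [e1]
  -- `sq1` is the square for the means, `sq2` the pointwise square for the fluctuations, integrated
  -- in `hint`.
  have sq1 := complete_square (P := P (k + 1)) (V := V (k + 1)) (Q := c.Q k + c.Qbar k)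
    (A := c.A k + c.Abar k) (C := c.C k + c.Cbar k) (B := c.B k + c.Bbar k)
    (D := c.D k + c.Dbar k) (S := c.S k + c.Sbar k) (R := c.R k + c.Rbar k)
    (Y := c.UpsilonBar k (P (k + 1)) (V (k + 1))) (H := c.HBar k (P (k + 1)) (V (k + 1)))
    hP hV ((hc.R k hk).add (hc.Rbar k hk)) rfl rfl (x := a)
    (hunit.imp And.right fun h0 => by rw [ha, h0]; simp) b
  have sq2 := fun s => complete_square (P := P (k + 1)) (V := P (k + 1)) (Q := c.Q k)
    (A := c.A k) (C := c.C k) (B := c.B k) (D := c.D k) (S := c.S k) (R := c.R k)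
    (Y := c.Upsilon k (P (k + 1))) (H := c.H k (P (k + 1)))
    hP hP (hc.R k hk) rfl rfl (x := x s - a)
    (hunit.imp And.left fun h0 => by rw [ha, h0]; simp) (u s - b)
  have hint := integral_congr_ae (μ := μ) (ae_of_all _ sq2)
  have hA := (hx'.mulVec (c.A k)).add (hu'.mulVec (c.B k))
  have hC := (hx'.mulVec (c.C k)).add (hu'.mulVec (c.D k))
  have hv := hu'.add ((hx'.mulVec (c.H k (P (k + 1)))).mulVec (c.Upsilon k (P (k + 1)))⁻¹)
  have iA := integrable_dotProduct (hA.mulVec (P (k + 1))).2 hA.2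
  have iC := integrable_dotProduct (hC.mulVec (P (k + 1))).2 hC.2
  have iAC := iA.fun_add iC
  rw [integral_add iAC (integrable_blockForm hx' hu' _ _ _), integral_add iA iC,
    integral_add (integrable_dotProduct (hx'.mulVec _).2 hx'.2)
      (integrable_dotProduct (hv.mulVec _).2 hv.2)] at hint
  have hb : ∀ y v, blockForm (c.Q k + c.Qbar k) (c.S k + c.Sbar k) (c.R k + c.Rbar k) y v
      = blockForm (c.Q k) (c.S k) (c.R k) y v
        + blockForm (c.Qbar k) (c.Sbar k) (c.Rbar k) y v := by
    intro y v
    simp only [blockForm, transpose_add, add_mulVec, add_dotProduct]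
    ring
  rw [hb] at sq1
  linarith

theorem cost_eq_add_sum_runningCost (hξ : Measurable ξ) (hω : IsNoise μ ξ ω N)
    {u : ℕ → Ω → Fin m → ℝ} (hu : Admissible μ ξ ω N u) :
    cost c μ ω N (fun _ => 0) u
      = meanFieldForm μ c.G (c.G + c.Gbar) (state c μ ω (fun _ => 0) u N)
        + ∑ k ∈ Finset.range N, runningCost c μ k (state c μ ω (fun _ => 0) u k) (u k) := by
  have hx : ∀ k ≤ N, SqIntegrable (info ξ ω k) μ (state c μ ω (fun _ => 0) u k) := fun k hk =>
    sqIntegrable_state hξ hω hk fun j hj => hu j (hj.trans_le hk)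
  have hxN := hx N le_rfl
  have i1 : Integrable (fun s => (c.G *ᵥ state c μ ω (fun _ => 0) u N s)
      ⬝ᵥ state c μ ω (fun _ => 0) u N s) μ := integrable_dotProduct (hxN.mulVec _).2 hxN.2
  have i2 := i1.fun_add (integrable_const ((c.Gbar *ᵥ ∫ t, state c μ ω (fun _ => 0) u N t ∂μ)
      ⬝ᵥ ∫ t, state c μ ω (fun _ => 0) u N t ∂μ))
  have i3 : ∀ k ∈ Finset.range N, Integrable (fun s => blockForm (c.Q k) (c.S k) (c.R k)
      (state c μ ω (fun _ => 0) u k s) (u k s)) μ := fun k hk =>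
    integrable_blockForm (hx k (Finset.mem_range.1 hk).le) (hu k (Finset.mem_range.1 hk)) _ _ _
  have i4 := fun k hk => (i3 k hk).fun_add (integrable_const (blockForm (c.Qbar k) (c.Sbar k)
    (c.Rbar k) (∫ t, state c μ ω (fun _ => 0) u k t ∂μ) (∫ t, u k t ∂μ)))
  simp only [cost]
  rw [integral_add i2 (integrable_finsetSum _ i4), integral_add i1 (integrable_const _),
    integral_finsetSum _ i4, integral_quadratic_eq_meanFieldForm hxN]
  congr 1
  · simp only [meanFieldForm, add_mulVec, add_dotProduct, integral_const, probReal_univ, one_smul]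
    ring
  · refine Finset.sum_congr rfl fun k hk => ?_
    rw [integral_add (i3 k hk) (integrable_const _)]
    simp [runningCost]

/-- The one-step identity telescopes; the initial form vanishes because the state starts at zero,
and the terminal conditions match the terminal cost. -/
theorem cost_eq_sum_meanFieldForm (hc : c.SymmetricWeights N) (hξ : Measurable ξ)
    (hω : IsNoise μ ξ ω N) {P V : ℕ → Matrix (Fin n) (Fin n) ℝ}
    (h : SolvesInverseRiccati c N P V) {u : ℕ → Ω → Fin m → ℝ} (hu : Admissible μ ξ ω N u)
    (hunit : ∀ k < N, (IsUnit (c.Upsilon k (P (k + 1)))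
        ∧ IsUnit (c.UpsilonBar k (P (k + 1)) (V (k + 1))))
      ∨ state c μ ω (fun _ => 0) u k = fun _ => 0) :
    cost c μ ω N (fun _ => 0) u = ∑ k ∈ Finset.range N,
      meanFieldForm μ (c.Upsilon k (P (k + 1))) (c.UpsilonBar k (P (k + 1)) (V (k + 1)))
        (fun s => u k s + feedback c μ k (P (k + 1)) (V (k + 1))
          (state c μ ω (fun _ => 0) u k) s) := by
  have key : ∀ M ≤ N, meanFieldForm μ (P M) (V M) (state c μ ω (fun _ => 0) u M)
      + ∑ k ∈ Finset.range M, runningCost c μ k (state c μ ω (fun _ => 0) u k) (u k)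
      = ∑ k ∈ Finset.range M,
        meanFieldForm μ (c.Upsilon k (P (k + 1))) (c.UpsilonBar k (P (k + 1)) (V (k + 1)))
          (fun s => u k s + feedback c μ k (P (k + 1)) (V (k + 1))
            (state c μ ω (fun _ => 0) u k) s) := by
    intro M hM
    induction M with
    | zero => simp [meanFieldForm, state]
    | succ M ih =>
      have hx : SqIntegrable (info ξ ω M) μ (state c μ ω (fun _ => 0) u M) :=
        sqIntegrable_state hξ hω (by omega) fun j hj => hu j (by omega)
      have step := meanFieldForm_nextState_add_runningCost hc hξ hω h hM hx (hu M hM)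
        (hunit M hM)
      rw [Finset.sum_range_succ, Finset.sum_range_succ, ← ih (by omega), state_succ]
      linarith
  rw [cost_eq_add_sum_runningCost hξ hω hu, ← key N le_rfl, h.terminal_P, h.terminal_V]

end Probability

end Dynamics

/-! ### Sufficiency: mean-square bounds for the control in terms of the gaps -/

section Sufficiency

variable {n m N p q : ℕ} {Ω : Type*} {mΩ : MeasurableSpace Ω} {μ : Measure Ω}
  {ξ : Ω → Fin n → ℝ} {ω : ℕ → Ω → ℝ} {c : Coeffs n m}

/-- `𝔼|f|²`. -/
noncomputable def secondMoment (μ : Measure Ω) (f : Ω → Fin p → ℝ) : ℝ :=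
  ∫ s, f s ⬝ᵥ f s ∂μ

theorem secondMoment_nonneg (f : Ω → Fin p → ℝ) : 0 ≤ secondMoment μ f :=
  integral_nonneg fun s => dotProduct_self_nonneg (f s)

variable [IsProbabilityMeasure μ]

theorem secondMoment_eq_meanFieldForm {𝓕 : MeasurableSpace Ω} {f : Ω → Fin p → ℝ}
    (hf : SqIntegrable 𝓕 μ f) : secondMoment μ f = meanFieldForm μ 1 1 f := by
  rw [← integral_quadratic_eq_meanFieldForm hf]
  simp [secondMoment]

theorem mul_secondMoment_le_meanFieldForm {𝓕 : MeasurableSpace Ω}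
    {f : Ω → Fin p → ℝ} (hf : SqIntegrable 𝓕 μ f) {α : ℝ} {P V : Matrix (Fin p) (Fin p) ℝ}
    (hP : ∀ v : Fin p → ℝ, α * (v ⬝ᵥ v) ≤ (P *ᵥ v) ⬝ᵥ v)
    (hV : ∀ v : Fin p → ℝ, α * (v ⬝ᵥ v) ≤ (V *ᵥ v) ⬝ᵥ v) :
    α * secondMoment μ f ≤ meanFieldForm μ P V f := by
  have hf' : SqIntegrable 𝓕 μ fun s => f s - ∫ t, f t ∂μ := hf.sub (.const _)
  rw [secondMoment_eq_meanFieldForm hf, meanFieldForm, meanFieldForm, mul_add,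
    ← integral_const_mul]
  simp only [one_mulVec]
  exact add_le_add (integral_mono ((integrable_dotProduct hf'.2 hf'.2).const_mul α)
    (integrable_dotProduct (hf'.mulVec P).2 hf'.2) fun s => hP _) (hV _)

/-- A transformation of a pair of square integrable random vectors with square integrable values
that is bounded in mean square. -/
def MeanSquareBounded (μ : Measure Ω)
    (T : (Ω → Fin n → ℝ) → (Ω → Fin m → ℝ) → Ω → Fin p → ℝ) : Prop :=
  ∃ K : ℝ, 0 ≤ K ∧ ∀ x u, SqIntegrable mΩ μ x → SqIntegrable mΩ μ u →
    SqIntegrable mΩ μ (T x u) ∧ secondMoment μ (T x u) ≤ K * (secondMoment μ x + secondMoment μ u)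

namespace MeanSquareBounded

variable {T T' : (Ω → Fin n → ℝ) → (Ω → Fin m → ℝ) → Ω → Fin p → ℝ}

omit [IsProbabilityMeasure μ] in
theorem fst : MeanSquareBounded μ fun (x : Ω → Fin n → ℝ) (_ : Ω → Fin m → ℝ) => x :=
  ⟨1, zero_le_one, fun x u hx _ => ⟨hx, by linarith [secondMoment_nonneg (μ := μ) u]⟩⟩

omit [IsProbabilityMeasure μ] in
theorem snd : MeanSquareBounded μ fun (_ : Ω → Fin n → ℝ) (u : Ω → Fin m → ℝ) => u :=
  ⟨1, zero_le_one, fun x u _ hu => ⟨hu, by linarith [secondMoment_nonneg (μ := μ) x]⟩⟩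

omit [IsProbabilityMeasure μ] in
theorem add (hT : MeanSquareBounded μ T) (hT' : MeanSquareBounded μ T') :
    MeanSquareBounded μ fun x u s => T x u s + T' x u s := by
  obtain ⟨K, hK, h⟩ := hT
  obtain ⟨K', hK', h'⟩ := hT'
  refine ⟨2 * K + 2 * K', by positivity, fun x u hx hu => ?_⟩
  obtain ⟨i, b⟩ := h x u hx hu
  obtain ⟨i', b'⟩ := h' x u hx hu
  refine ⟨i.add i', ?_⟩
  have j := integrable_dotProduct i.2 i.2
  have j' := integrable_dotProduct i'.2 i'.2
  have key : secondMoment μ (fun s => T x u s + T' x u s)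
      ≤ ∫ s, (2 * (T x u s ⬝ᵥ T x u s) + 2 * (T' x u s ⬝ᵥ T' x u s)) ∂μ :=
    integral_mono (integrable_dotProduct (i.add i').2 (i.add i').2)
      ((j.const_mul 2).add (j'.const_mul 2)) fun s => add_dotProduct_add_self_le _ _
  rw [integral_add (j.const_mul 2) (j'.const_mul 2), integral_const_mul,
    integral_const_mul] at key
  simp only [secondMoment] at *
  linarith

omit [IsProbabilityMeasure μ] in
theorem mulVec (hT : MeanSquareBounded μ T) (M : Matrix (Fin q) (Fin p) ℝ) :
    MeanSquareBounded μ fun x u s => M *ᵥ T x u s := by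
  obtain ⟨K, hK, h⟩ := hT
  obtain ⟨L, hL, hM⟩ := exists_mulVec_dotProduct_self_le M
  refine ⟨L * K, by positivity, fun x u hx hu => ?_⟩
  obtain ⟨i, b⟩ := h x u hx hu
  refine ⟨i.mulVec M, ?_⟩
  have key : secondMoment μ (fun s => M *ᵥ T x u s) ≤ ∫ s, L * (T x u s ⬝ᵥ T x u s) ∂μ :=
    integral_mono (integrable_dotProduct (i.mulVec M).2 (i.mulVec M).2)
      ((integrable_dotProduct i.2 i.2).const_mul L) fun s => hM _
  rw [integral_const_mul] at key
  rw [mul_assoc]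
  exact key.trans (mul_le_mul_of_nonneg_left b hL)

/-- The second moment is the variance plus the squared mean. -/
theorem mean (hT : MeanSquareBounded μ T) :
    MeanSquareBounded μ fun x u _ => ∫ t, T x u t ∂μ := by
  obtain ⟨K, hK, h⟩ := hT
  refine ⟨K, hK, fun x u hx hu => ⟨.const _, ?_⟩⟩
  obtain ⟨i, b⟩ := h x u hx hu
  refine le_trans ?_ b
  rw [secondMoment_eq_meanFieldForm i, meanFieldForm]
  simp only [one_mulVec, secondMoment, integral_const, probReal_univ, one_smul]
  exact le_add_of_nonneg_left (integral_nonneg fun s => dotProduct_self_nonneg _)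

theorem drift (c : Coeffs n m) (k : ℕ) : MeanSquareBounded μ (drift c μ k) :=
  (((fst.mulVec _).add (fst.mean.mulVec _)).add (snd.mulVec _)).add (snd.mean.mulVec _)

theorem diffusion (c : Coeffs n m) (k : ℕ) : MeanSquareBounded μ (diffusion c μ k) :=
  (((fst.mulVec _).add (fst.mean.mulVec _)).add (snd.mulVec _)).add (snd.mean.mulVec _)

theorem feedbackControl (c : Coeffs n m) (k : ℕ) (P V : Matrix (Fin n) (Fin n) ℝ) :
    MeanSquareBounded μ fun x v s => v s + -feedback c μ k P V x s := by
  -- Subtraction is written as adding the image under `-1`, so that closure under sums and matrices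
  -- suffices.
  have h1 : MeanSquareBounded μ fun (x : Ω → Fin n → ℝ) (_ : Ω → Fin m → ℝ) s =>
      x s + (-1 : Matrix (Fin n) (Fin n) ℝ) *ᵥ ∫ t, x t ∂μ := fst.add (fst.mean.mulVec _)
  have h2 := snd.add ((((h1.mulVec (c.H k P)).mulVec (c.Upsilon k P)⁻¹).add
    ((fst.mean.mulVec (c.HBar k P V)).mulVec (c.UpsilonBar k P V)⁻¹)).mulVec
      (-1 : Matrix (Fin m) (Fin m) ℝ))
  simpa only [feedback, neg_mulVec, one_mulVec, sub_eq_add_neg] using h2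

end MeanSquareBounded

/-- The second moment of the next state is the sum of those of drift and diffusion. This needs
arguments measurable with respect to the past, so `MeanSquareBounded` cannot express it. -/
theorem exists_secondMoment_nextState_le (hξ : Measurable ξ) (hω : IsNoise μ ξ ω N)
    (c : Coeffs n m) {k : ℕ} (hk : k < N) :
    ∃ K : ℝ, 0 ≤ K ∧ ∀ x u, SqIntegrable (info ξ ω k) μ x → SqIntegrable (info ξ ω k) μ u →
      secondMoment μ (nextState c μ ω k x u) ≤ K * (secondMoment μ x + secondMoment μ u) := by
  obtain ⟨K, hK, h⟩ := MeanSquareBounded.drift (μ := μ) c k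
  obtain ⟨K', hK', h'⟩ := MeanSquareBounded.diffusion (μ := μ) c k
  refine ⟨K + K', by positivity, fun x u hx hu => ?_⟩
  have hle := info_le hξ hω hk.le
  have b := (h x u (hx.mono hle) (hu.mono hle)).2
  have b' := (h' x u (hx.mono hle) (hu.mono hle)).2
  rw [secondMoment_eq_meanFieldForm (hx.nextState hξ hω hk hu),
    meanFieldForm_nextState hξ hω hk hx hu, ← secondMoment_eq_meanFieldForm (hx.drift hu),
    ← secondMoment_eq_meanFieldForm (hx.diffusion hu)]
  linarith

omit [IsProbabilityMeasure μ] in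
theorem secondMoment_eq_integral_sum {u : ℕ → Ω → Fin m → ℝ} (hu : Admissible μ ξ ω N u) :
    ∫ s, ∑ k ∈ Finset.range N, u k s ⬝ᵥ u k s ∂μ
      = ∑ k ∈ Finset.range N, secondMoment μ (u k) :=
  integral_finsetSum _ fun k hk =>
    integrable_dotProduct (hu k (Finset.mem_range.1 hk)).2 (hu k (Finset.mem_range.1 hk)).2

/-- The deviation of the control from the optimal feedback control. -/
noncomputable def controlGap (c : Coeffs n m) (μ : Measure Ω) (ω : ℕ → Ω → ℝ)
    (P V : ℕ → Matrix (Fin n) (Fin n) ℝ) (u : ℕ → Ω → Fin m → ℝ) (k : ℕ) (s : Ω) :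
    Fin m → ℝ :=
  u k s + feedback c μ k (P (k + 1)) (V (k + 1)) (state c μ ω (fun _ => 0) u k) s

theorem exists_secondMoment_control_le (hξ : Measurable ξ) (hω : IsNoise μ ξ ω N)
    (c : Coeffs n m) (P V : ℕ → Matrix (Fin n) (Fin n) ℝ) {k : ℕ} (hk : k < N) :
    ∃ K : ℝ, 0 ≤ K ∧ ∀ u, Admissible μ ξ ω N u → secondMoment μ (u k)
      ≤ K * (secondMoment μ (state c μ ω (fun _ => 0) u k)
        + secondMoment μ (controlGap c μ ω P V u k)) := by
  obtain ⟨K, hK, h⟩ :=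
    MeanSquareBounded.feedbackControl (μ := μ) c k (P (k + 1)) (V (k + 1))
  refine ⟨K, hK, fun u hu => ?_⟩
  have hle := info_le hξ hω hk.le
  have hx : SqIntegrable (info ξ ω k) μ (state c μ ω (fun _ => 0) u k) :=
    sqIntegrable_state hξ hω hk.le fun j hj => hu j (hj.trans hk)
  have hv : SqIntegrable (info ξ ω k) μ (controlGap c μ ω P V u k) :=
    SqIntegrable.add (hu k hk) (hx.feedback _ _)
  simpa [controlGap] using (h _ _ (hx.mono hle) (hv.mono hle)).2

/-- A discrete Gronwall argument: rewrite the control as gap minus feedback, so the gaps alone drive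
the state. The constant does not depend on `u`. -/
theorem exists_secondMoment_state_le (hξ : Measurable ξ) (hω : IsNoise μ ξ ω N)
    (c : Coeffs n m) (P V : ℕ → Matrix (Fin n) (Fin n) ℝ) {k : ℕ} (hk : k ≤ N) :
    ∃ K : ℝ, 0 ≤ K ∧ ∀ u, Admissible μ ξ ω N u →
      secondMoment μ (state c μ ω (fun _ => 0) u k)
        ≤ K * ∑ j ∈ Finset.range k, secondMoment μ (controlGap c μ ω P V u j) := by
  induction k with
  | zero => exact ⟨0, le_rfl, fun u _ => by simp [secondMoment, state]⟩
  | succ k ih =>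
    obtain ⟨K, hK, h⟩ := ih (by omega)
    obtain ⟨L, hL, hu⟩ := exists_secondMoment_control_le hξ hω c P V hk
    obtain ⟨M, hM, hx⟩ := exists_secondMoment_nextState_le hξ hω c hk
    refine ⟨M * (K + L * (K + 1)), by positivity, fun u had => ?_⟩
    have b1 := h u had
    have b2 := hu u had
    have b3 := hx _ (u k)
      (sqIntegrable_state (c := c) hξ hω (by omega) fun j hj => had j (by omega)) (had k hk)
    rw [Finset.sum_range_succ, state_succ]
    set a := secondMoment μ (state c μ ω (fun _ => 0) u k)
    set g := secondMoment μ (controlGap c μ ω P V u k)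
    set t := ∑ j ∈ Finset.range k, secondMoment μ (controlGap c μ ω P V u j)
    have hg : 0 ≤ g := secondMoment_nonneg _
    have ht : 0 ≤ t := Finset.sum_nonneg fun j _ => secondMoment_nonneg _
    have c1 : a ≤ K * (t + g) := b1.trans (mul_le_mul_of_nonneg_left (by linarith) hK)
    have c2 : secondMoment μ (u k) ≤ L * ((K + 1) * (t + g)) :=
      b2.trans (mul_le_mul_of_nonneg_left (by linarith) hL)
    calc _ ≤ M * (a + secondMoment μ (u k)) := b3
      _ ≤ M * (K * (t + g) + L * ((K + 1) * (t + g))) :=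
        mul_le_mul_of_nonneg_left (add_le_add c1 c2) hM
      _ = _ := by ring

theorem exists_sum_secondMoment_control_le (hξ : Measurable ξ) (hω : IsNoise μ ξ ω N)
    (c : Coeffs n m) (P V : ℕ → Matrix (Fin n) (Fin n) ℝ) :
    ∃ K : ℝ, 0 ≤ K ∧ ∀ u, Admissible μ ξ ω N u →
      ∑ k ∈ Finset.range N, secondMoment μ (u k)
        ≤ K * ∑ k ∈ Finset.range N, secondMoment μ (controlGap c μ ω P V u k) := by
  have key : ∀ k : ℕ, ∃ K : ℝ, 0 ≤ K ∧ (k < N → ∀ u, Admissible μ ξ ω N u →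
      secondMoment μ (u k)
        ≤ K * ∑ j ∈ Finset.range N, secondMoment μ (controlGap c μ ω P V u j)) := by
    intro k
    by_cases hk : k < N
    swap
    -- A dummy constant beyond the horizon, so that `choose` yields a function on all of `ℕ`.
    · exact ⟨0, le_rfl, fun h => absurd h hk⟩
    obtain ⟨K, hK, h⟩ := exists_secondMoment_state_le hξ hω c P V hk.le
    obtain ⟨L, hL, hu⟩ := exists_secondMoment_control_le hξ hω c P V hk
    refine ⟨L * (K + 1), by positivity, fun _ u had => ?_⟩
    have hg : ∀ j, 0 ≤ secondMoment μ (controlGap c μ ω P V u j) := fun j =>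
      secondMoment_nonneg _
    have s1 : ∑ j ∈ Finset.range k, secondMoment μ (controlGap c μ ω P V u j)
        ≤ ∑ j ∈ Finset.range N, secondMoment μ (controlGap c μ ω P V u j) :=
      Finset.sum_le_sum_of_subset_of_nonneg (Finset.range_mono hk.le) fun j _ _ => hg j
    have s2 : secondMoment μ (controlGap c μ ω P V u k)
        ≤ ∑ j ∈ Finset.range N, secondMoment μ (controlGap c μ ω P V u j) :=
      Finset.single_le_sum (f := fun j => secondMoment μ (controlGap c μ ω P V u j))
        (fun j _ => hg j) (Finset.mem_range.2 hk)
    have b := (h u had).trans (mul_le_mul_of_nonneg_left s1 hK)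
    rw [mul_assoc]
    exact (hu u had).trans (mul_le_mul_of_nonneg_left (by linarith) hL)
  choose K hK h using key
  refine ⟨∑ k ∈ Finset.range N, K k, Finset.sum_nonneg fun k _ => hK k, fun u had => ?_⟩
  rw [Finset.sum_mul]
  exact Finset.sum_le_sum fun k hk => h k (Finset.mem_range.1 hk) u had

theorem StronglyRegularlySolvable.uniformlyConvex (hξ : Measurable ξ) (hω : IsNoise μ ξ ω N)
    (hc : c.SymmetricWeights N) (h : StronglyRegularlySolvable c N) :
    UniformlyConvex c μ ξ ω N := by
  obtain ⟨P, V, hsol, hreg⟩ := h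
  have hinv := hsol.solvesInverseRiccati hreg
  obtain ⟨α, hα, hreg⟩ := hreg
  obtain ⟨K, hK, hb⟩ := exists_sum_secondMoment_control_le hξ hω c P V
  -- `K + 1` rather than `K`, which may be zero.
  refine ⟨α / (K + 1), by positivity, fun u hu => ?_⟩
  rw [secondMoment_eq_integral_sum hu, cost_eq_sum_meanFieldForm hc hξ hω hinv hu fun k hk =>
    Or.inl ⟨isUnit_of_posSemidef_sub_smul_one hα (hreg k hk).1,
      isUnit_of_posSemidef_sub_smul_one hα (hreg k hk).2⟩]
  have hg : 0 ≤ ∑ k ∈ Finset.range N, secondMoment μ (controlGap c μ ω P V u k) :=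
    Finset.sum_nonneg fun j _ => secondMoment_nonneg _
  calc _ ≤ α / (K + 1) * ((K + 1)
        * ∑ k ∈ Finset.range N, secondMoment μ (controlGap c μ ω P V u k)) := by
        refine mul_le_mul_of_nonneg_left ?_ (by positivity)
        linarith [hb u hu]
    _ = ∑ k ∈ Finset.range N, α * secondMoment μ (controlGap c μ ω P V u k) := by
        rw [← Finset.mul_sum]
        field_simp
    _ ≤ _ := Finset.sum_le_sum fun k hk => ?_
  have hk := Finset.mem_range.1 hk
  obtain ⟨hP, hV⟩ := hinv.isSymm hc (Nat.succ_le_of_lt hk)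
  have hx : SqIntegrable (info ξ ω k) μ (state c μ ω (fun _ => 0) u k) :=
    sqIntegrable_state hξ hω hk.le fun j hj => hu j (hj.trans hk)
  exact mul_secondMoment_le_meanFieldForm (SqIntegrable.add (hu k hk) (hx.feedback _ _))
    ((posSemidef_sub_smul_one_iff (hc.upsilon_isSymm hk hP) α).1 (hreg k hk).1)
    ((posSemidef_sub_smul_one_iff (hc.upsilonBar_isSymm hk hP hV) α).1 (hreg k hk).2)

end Sufficiency

/-! ### Necessity: test controls and backward induction -/

section Necessity

variable {n m N : ℕ} {Ω : Type*} {mΩ : MeasurableSpace Ω} {μ : Measure Ω}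
  {ξ : Ω → Fin n → ℝ} {ω : ℕ → Ω → ℝ} {c : Coeffs n m}

/-- The state, started in zero, under the feedback law `φ`. -/
noncomputable def closedLoopState (c : Coeffs n m) (μ : Measure Ω) (ω : ℕ → Ω → ℝ)
    (φ : ℕ → (Ω → Fin n → ℝ) → Ω → Fin m → ℝ) : ℕ → Ω → Fin n → ℝ
  | 0 => fun _ => 0
  | k + 1 => nextState c μ ω k (closedLoopState c μ ω φ k) (φ k (closedLoopState c μ ω φ k))

/-- Admissible controls are processes, not feedback laws: the law is run first, and the control it
produced is then replayed. A law acts on the whole random vector because the optimal feedback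
involves its mean. -/
theorem state_closedLoop (φ : ℕ → (Ω → Fin n → ℝ) → Ω → Fin m → ℝ) (k : ℕ) :
    state c μ ω (fun _ => 0) (fun j => φ j (closedLoopState c μ ω φ j)) k
      = closedLoopState c μ ω φ k := by
  induction k with
  | zero => rfl
  | succ k ih => rw [state_succ, ih, closedLoopState]

theorem nextState_zero (c : Coeffs n m) (μ : Measure Ω) (ω : ℕ → Ω → ℝ) (k : ℕ) :
    nextState c μ ω k (fun _ => 0) (fun _ => 0) = fun _ => 0 := by
  funext s
  simp [nextState, drift, diffusion]

variable [IsProbabilityMeasure μ]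

theorem admissible_closedLoop (hξ : Measurable ξ) (hω : IsNoise μ ξ ω N)
    {φ : ℕ → (Ω → Fin n → ℝ) → Ω → Fin m → ℝ}
    (hφ : ∀ k < N, ∀ x, SqIntegrable (info ξ ω k) μ x → SqIntegrable (info ξ ω k) μ (φ k x)) :
    Admissible μ ξ ω N fun j => φ j (closedLoopState c μ ω φ j) := by
  have key : ∀ k ≤ N, SqIntegrable (info ξ ω k) μ (closedLoopState c μ ω φ k) := by
    intro k hk
    induction k with
    | zero => exact .const 0
    | succ k ih => exact (ih (by omega)).nextState hξ hω hk (hφ k hk _ (ih (by omega)))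
  exact fun k hk => hφ k hk _ (key k hk.le)

/-- A perturbation at time `K`, followed by the optimal feedback, costs exactly the quadratic
form of the Riccati equations at time `K`. -/
theorem exists_admissible_cost_eq_meanFieldForm (hξ : Measurable ξ) (hω : IsNoise μ ξ ω N)
    (hc : c.SymmetricWeights N) {P V : ℕ → Matrix (Fin n) (Fin n) ℝ}
    (h : SolvesInverseRiccati c N P V) {K : ℕ} (hK : K < N)
    (hunit : ∀ k, K < k → k < N → IsUnit (c.Upsilon k (P (k + 1)))
      ∧ IsUnit (c.UpsilonBar k (P (k + 1)) (V (k + 1))))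
    {w : Ω → Fin m → ℝ} (hw : SqIntegrable (info ξ ω K) μ w) :
    ∃ u, Admissible μ ξ ω N u ∧ u K = w ∧ cost c μ ω N (fun _ => 0) u
      = meanFieldForm μ (c.Upsilon K (P (K + 1))) (c.UpsilonBar K (P (K + 1)) (V (K + 1))) w := by
  let φ : ℕ → (Ω → Fin n → ℝ) → Ω → Fin m → ℝ := fun j x =>
    if j < K then fun _ => 0 else if j = K then w else
      fun s => -feedback c μ j (P (j + 1)) (V (j + 1)) x s
  have hφ_lt : ∀ {j} x, j < K → φ j x = fun _ => 0 := fun x hj => if_pos hj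
  have hφ_eq : ∀ x, φ K x = w := fun x => by simp [φ]
  have hφ_gt : ∀ {j} x, K < j →
      φ j x = fun s => -feedback c μ j (P (j + 1)) (V (j + 1)) x s := fun x hj => by
    simp [φ, hj.not_gt, hj.ne']
  have hφ : ∀ k < N, ∀ x, SqIntegrable (info ξ ω k) μ x →
      SqIntegrable (info ξ ω k) μ (φ k x) := by
    intro k _ x hx
    rcases lt_trichotomy k K with hlt | rfl | hgt
    · rw [hφ_lt x hlt]
      exact .const 0
    · rwa [hφ_eq]
    · rw [hφ_gt x hgt]
      exact (hx.feedback _ _).neg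
  have hzero : ∀ k ≤ K, closedLoopState c μ ω φ k = fun _ => 0 := by
    intro k hk
    induction k with
    | zero => rfl
    | succ k ih => rw [closedLoopState, ih (by omega), hφ_lt _ hk, nextState_zero]
  have hadm : Admissible μ ξ ω N fun j => φ j (closedLoopState c μ ω φ j) :=
    admissible_closedLoop hξ hω hφ
  refine ⟨_, hadm, hφ_eq _, ?_⟩
  -- Up to time `K` the state is zero, so invertibility is needed only after `K`. The gap vanishes
  -- at every time other than `K`, where it is `w`.
  rw [cost_eq_sum_meanFieldForm hc hξ hω h hadm fun k hk => ?_]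
  · simp only [state_closedLoop]
    rw [Finset.sum_eq_single_of_mem K (Finset.mem_range.2 hK)]
    · rw [hφ_eq, hzero K le_rfl]
      congr 1
      funext s
      simp [feedback]
    · intro k _ hne
      rcases hne.lt_or_gt with hlt | hgt
      · rw [hφ_lt _ hlt, hzero k hlt.le]
        simp [feedback, meanFieldForm]
      · rw [hφ_gt _ hgt]
        simp [meanFieldForm]
  · rw [state_closedLoop]
    rcases le_or_gt k K with hle | hgt
    · exact Or.inr (hzero k hle)
    · exact Or.inl (hunit k hgt hk)

/-- A random vector that is not almost surely constant generates a nonzero bounded centered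
random variable. -/
theorem exists_centered_of_not_ae_const (hξ : Measurable ξ)
    (hne : ¬ ∃ a : Fin n → ℝ, ξ =ᵐ[μ] fun _ => a) :
    ∃ η : Ω → ℝ, Measurable[MeasurableSpace.comap ξ inferInstance] η ∧ MemLp η 2 μ ∧
      ∫ s, η s ∂μ = 0 ∧ 0 < ∫ s, η s ^ 2 ∂μ := by
  -- Countably many measurable sets separate points of `ℝⁿ`; if each measurable set held `ξ` almost
  -- surely or almost never, `ξ` would be almost surely constant.
  have hU : ∃ U : Set (Fin n → ℝ), MeasurableSet U ∧
      ¬ (∀ᵐ s ∂μ, ξ s ∈ U) ∧ ¬ ∀ᵐ s ∂μ, ξ s ∉ U := by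
    by_contra! hcon
    exact hne (Filter.exists_eventuallyEq_const_of_forall_separating MeasurableSet fun U hU =>
      or_iff_not_imp_left.2 fun h => hcon U hU (Filter.not_eventually.1 h))
  obtain ⟨U, hU, h1, h2⟩ := hU
  have hA : MeasurableSet[MeasurableSpace.comap ξ inferInstance] (ξ ⁻¹' U) := ⟨U, hU, rfl⟩
  have hA' : MeasurableSet (ξ ⁻¹' U) := hξ hU
  have hm : Measurable[MeasurableSpace.comap ξ inferInstance]
      fun s => (ξ ⁻¹' U).indicator (fun _ => (1 : ℝ)) s - μ.real (ξ ⁻¹' U) :=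
    (measurable_const.indicator hA).sub_const _
  have hL : MemLp (fun s => (ξ ⁻¹' U).indicator (fun _ => (1 : ℝ)) s - μ.real (ξ ⁻¹' U)) 2 μ :=
    ((memLp_const (1 : ℝ)).indicator hA').sub (memLp_const _)
  have hi : Integrable ((ξ ⁻¹' U).indicator fun _ => (1 : ℝ)) μ :=
    (integrable_const 1).indicator hA'
  refine ⟨_, hm, hL, ?_, ?_⟩
  · rw [integral_sub hi (integrable_const _), integral_indicator_const _ hA']
    simp
  · refine (integral_nonneg fun s => sq_nonneg _).lt_of_ne fun h0 => ?_
    -- Zero variance makes the indicator of `ξ ∈ U` almost surely equal to its probability, which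
    -- forces the event to hold almost surely or to fail almost surely.
    have hae := (integral_eq_zero_iff_of_nonneg (fun s => sq_nonneg _) hL.integrable_sq).1 h0.symm
    by_cases hp : μ.real (ξ ⁻¹' U) = 1
    · refine h1 (hae.mono fun s hs => ?_)
      by_contra hsU
      have : s ∉ ξ ⁻¹' U := hsU
      simp [this, hp] at hs
    · refine h2 (hae.mono fun s hs hsU => hp ?_)
      have : s ∈ ξ ⁻¹' U := hsU
      simp only [Set.indicator_of_mem this, Pi.zero_apply, sq_eq_zero_iff, sub_eq_zero] at hs
      exact hs.symm

theorem UniformlyConvex.stronglyRegularlySolvable (hξ : Measurable ξ) (hω : IsNoise μ ξ ω N)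
    (hc : c.SymmetricWeights N) (hne : ¬ ∃ a : Fin n → ℝ, ξ =ᵐ[μ] fun _ => a)
    (hconv : UniformlyConvex c μ ξ ω N) : StronglyRegularlySolvable c N := by
  obtain ⟨P, V, h⟩ := exists_solvesInverseRiccati c N
  obtain ⟨α, hα, hconv⟩ := hconv
  obtain ⟨η, hηm, hηL, hη0, hηpos⟩ := exists_centered_of_not_ae_const hξ hne
  -- The convexity constant itself serves as regularity constant at every time. The bound is stated
  -- for all times from `K` on because the test control at `K` needs invertibility at all later
  -- times.
  suffices key : ∀ K ≤ N, ∀ k, K ≤ k → k < N →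
      (c.Upsilon k (P (k + 1)) - α • (1 : Matrix (Fin m) (Fin m) ℝ)).PosSemidef ∧
      (c.UpsilonBar k (P (k + 1)) (V (k + 1))
        - α • (1 : Matrix (Fin m) (Fin m) ℝ)).PosSemidef by
    have hreg : IsStronglyRegular c N P V := ⟨α, hα, fun k hk => key 0 N.zero_le k k.zero_le hk⟩
    exact ⟨P, V, h.isRiccatiSolution hreg, hreg⟩
  intro K hK
  induction hK using Nat.decreasingInduction with
  | self => exact fun k h1 h2 => absurd h2 h1.not_gt
  | of_succ K hK ih =>
    intro k hKk hk
    rcases hKk.eq_or_lt with rfl | hlt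
    swap
    · exact ih k hlt hk
    have bound : ∀ w : Ω → Fin m → ℝ, SqIntegrable (info ξ ω K) μ w →
        α * secondMoment μ w ≤ meanFieldForm μ (c.Upsilon K (P (K + 1)))
          (c.UpsilonBar K (P (K + 1)) (V (K + 1))) w := by
      intro w hw
      obtain ⟨u, hu, rfl, hcost⟩ := exists_admissible_cost_eq_meanFieldForm hξ hω hc h hK
        (fun k h1 h2 => (ih k h1 h2).imp (isUnit_of_posSemidef_sub_smul_one hα)
          (isUnit_of_posSemidef_sub_smul_one hα)) hw
      rw [← hcost]
      refine le_trans (mul_le_mul_of_nonneg_left ?_ hα.le) (hconv u hu)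
      rw [secondMoment_eq_integral_sum hu]
      exact Finset.single_le_sum (f := fun j => secondMoment μ (u j))
        (fun j _ => secondMoment_nonneg _) (Finset.mem_range.2 hK)
    obtain ⟨hP, hV⟩ := h.isSymm hc (Nat.succ_le_of_lt hK)
    rw [posSemidef_sub_smul_one_iff (hc.upsilon_isSymm hK hP),
      posSemidef_sub_smul_one_iff (hc.upsilonBar_isSymm hK hP hV)]
    refine ⟨fun z => ?_, fun z => ?_⟩
    -- As `η` is `σ(ξ)`-measurable, the same `η` is admissible at every time. The mean of `η z` is
    -- zero, so only `Υ_K` remains, and the factor `𝔼 η² > 0` cancels.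
    · have hw : SqIntegrable (info ξ ω K) μ fun s => η s • z := by
        refine ⟨(hηm.mono le_sup_left le_rfl).smul_const z, MemLp.of_eval fun i => ?_⟩
        simpa [mul_comm] using hηL.const_mul (z i)
      have hmean : ∫ s, η s • z ∂μ = 0 := by rw [integral_smul_const, hη0, zero_smul]
      have hb := bound _ hw
      simp only [secondMoment, meanFieldForm, hmean, sub_zero, mulVec_zero, zero_dotProduct,
        add_zero, mulVec_smul, smul_dotProduct, dotProduct_smul, smul_eq_mul, ← mul_assoc,
        ← sq, integral_mul_const] at hb
      refine le_of_mul_le_mul_left ?_ hηpos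
      linarith
    -- A constant control has no fluctuation and isolates `Ῡ_K`.
    · have hb := bound _ (.const z)
      simpa [secondMoment, meanFieldForm] using hb

end Necessity

end MFLQ

theorem theorem4p5 {n m N : ℕ} {Ω : Type*} [MeasurableSpace Ω]
    (μ : MeasureTheory.Measure Ω) [MeasureTheory.IsProbabilityMeasure μ]
    (ξ : Ω → Fin n → ℝ) (hξ : Measurable ξ)
    (ω : ℕ → Ω → ℝ) (hω : MFLQ.IsNoise μ ξ ω N)
    (c : MFLQ.Coeffs n m) (hc : c.SymmetricWeights N) :
    (MFLQ.StronglyRegularlySolvable c N → MFLQ.UniformlyConvex c μ ξ ω N) ∧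
    ((¬ ∃ a : Fin n → ℝ, ξ =ᵐ[μ] fun _ => a) →
      (MFLQ.UniformlyConvex c μ ξ ω N ↔ MFLQ.StronglyRegularlySolvable c N)) :=
  have suff (h : MFLQ.StronglyRegularlySolvable c N) : MFLQ.UniformlyConvex c μ ξ ω N :=
    h.uniformlyConvex hξ hω hc
  ⟨suff, fun hne => ⟨fun h => h.stronglyRegularlySolvable hξ hω hc hne, suff⟩⟩
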